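/- Let $k$ be a field, $0\le d\le n$, and let $I=\{i_1<\dots<i_d\}$, $J=\{j_1<\dots<j_d\}$ be $d$-element subsets of $\{1,\dots,n\}$ with $i_a\le j_a$ for all $a$. Varieties over $k$ are described by their functors of points on commutative $k$-algebras, and isomorphisms are isomorphisms of such functors. Notation. $[X]\in\mathrm{Gr}(d,n)$ is the row span of a $d\times n$ matrix $X$ of rank $d$; $GL_n$ acts on row vectors by $g\cdot v=vg^{T}$; $e_I$ is the $d\times n$ matrix whose $a$-th row is the $i_a$-th standard basis vector; $X_I$ is the submatrix of $X$ of the columns in $I$. With $B_n,B_n^-\subset GL_n$ the upper and lower triangular subgroups, let $Z_I^-=B_n^-\cdot[e_I]$, $Z_J^+=B_n\cdot[e_J]$, and let $R_{I,J}=Z_I^-\cap Z_J^+$ be the open Richardson variety. The base change map $\psi_{I,J}:R_{I,J}\to GL_d$ is $[X]\mapsto (X_I)^{-1}X_J$. Let $M_I^-$ be the set of $d\times n$ matrices $X$ with $X_I=1$ and $X_{a,l}=0$ for $l<i_a$, and $M_J^+$ the set of those with $X_J=1$ and $X_{a,l}=0$ for $l>j_a$. In $GL_d$ let $B,B^-$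 be the upper and lower triangular subgroups, $T$ the diagonal torus, and $U,U^-$ the unipotent radicals of $B,B^-$. Identify $w\in S_d$ with its permutation matrix ($e_l\mapsto e_{w(l)}$) and put $U^-_w=U^-\cap w^{-1}U^-w$. For $w\in S_d$, let $\ell(w)$ be its number of inversions; for a $d$-subset $I$ let $\ell(I)$ be the minimal length of a permutation $v\in S_n$ with $v(\{1,\dots,d\})=I$ (so $\ell(J)-\ell(I)=\sum_a (j_a-i_a)$). Theorem (Gauss-type decomposition). Let $w\in S_d$, and let $R^{w}=\psi_{I,J}^{-1}(BwB^-)\subset R_{I,J}$. (a) The row span map $X\mapsto[X]$ restricts to an isomorphism from the hybrid normal form $UM_I^-\cap wTU^-_wM_J^+$ onto $R^{w}$. (b) $R^{w}$ is non-empty if and only if $i_{w(a)}\le j_a$ for all $a\in\{1,\dots,d\}$; more precisely, for every nonzero commutative $k$-algebra $A$, $R^w(A)\neq\emptyset$ if and only if this condition holds. (c) If $i_{w(a)}\le j_a$ for all $a$, then $R^{w}\cong\mathbb G_m^\alpha\times\mathbb A^\beta$, where $\alpha=\#\{a: i_{w(a)}\ne j_a\}$ and $\beta=\ell(J)-\ell(I)-\alpha-\ell(w)$.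 -/

import Mathlib

open CategoryTheory TensorProduct

namespace GaussDecomposition

universe u

noncomputable section

/-! Varieties over the field `k` are described by their functors of points
`CommAlgCat k ⥤ Type`, their subvarieties by subfunctors, and morphisms by natural
transformations; by the Yoneda lemma, isomorphisms of varieties are the natural isomorphisms of
these functors. -/

/-! ### Matrices, full-rank matrices, and the Grassmannian -/

/-- The affine space of `d × n` matrices, as a functor of points. -/
def matFunctor (k : Type u) [Field k] (d n : ℕ) : CommAlgCat.{u} k ⥤ Type u where
  obj A := Matrix (Fin d) (Fin n) A
  map f := ↾fun X => X.map f.hom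
  map_id A := by ext X; rfl
  map_comp f g := by ext X; rfl

/-- The group scheme `GL_d`, as a functor of points. -/
def glFunctor (k : Type u) [Field k] (d : ℕ) : CommAlgCat.{u} k ⥤ Type u where
  obj A := GL (Fin d) A
  map f := ↾fun g => Matrix.GeneralLinearGroup.map f.hom.toRingHom g
  map_id A := by ext X; rfl
  map_comp f g := by ext X; rfl

/-- `V_{d,n}`: the `d × n` matrices of full rank `d`. Over a ring this means that the rows form
a basis of a direct summand, i.e. that there is a right inverse. -/
def fullRank (k : Type u) [Field k] (d n : ℕ) : Subfunctor (matFunctor k d n) where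
  obj A := {X : Matrix (Fin d) (Fin n) A | ∃ Y : Matrix (Fin n) (Fin d) A, X * Y = 1}
  map {A B} f := by
    rintro X ⟨Y, hY⟩
    refine ⟨Y.map f.hom, ?_⟩
    have h := congrArg (fun M => M.map f.hom) hY
    rw [Matrix.map_one _ (map_zero f.hom) (map_one f.hom)] at h
    exact Matrix.map_mul.symm.trans h

/-- `Z = Gr(d,n)`: the Grassmannian of rank `d` direct summands of `A ⊗ k^n`.
Mathlib's convention is to record the rank `n - d` of the quotient. -/
abbrev gr (k : Type u) [Field k] (d n : ℕ) : CommAlgCat.{u} k ⥤ Type u :=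
  Module.Grassmannian.functor (R := k) (M := Fin n → k) (n - d)

/-- The canonical identification of row vectors over `A` with `A ⊗ k^n`. -/
def coord (k : Type u) [Field k] (n : ℕ) (A : Type u) [CommRing A] [Algebra k A] :
    (Fin n → A) ≃ₗ[A] A ⊗[k] (Fin n → k) :=
  (TensorProduct.piScalarRight k A A (Fin n)).symm

/-- The span of the rows of a matrix, as a submodule of `A ⊗ k^n`. -/
def rowSubmodule (k : Type u) [Field k] {d n : ℕ} {A : Type u} [CommRing A] [Algebra k A]
    (X : Matrix (Fin d) (Fin n) A) : Submodule A (A ⊗[k] (Fin n → k)) :=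
  (Submodule.span A (Set.range fun i => X i)).map (coord k n A).toLinearMap

lemma span_rows_eq_range {d n : ℕ} {A : Type u} [CommRing A] (X : Matrix (Fin d) (Fin n) A) :
    Submodule.span A (Set.range fun i => X i) = LinearMap.range X.vecMulLinear := by
  rw [range_vecMulLinear]; rfl

lemma isCompl_rows {d n : ℕ} {A : Type u} [CommRing A]
    (X : Matrix (Fin d) (Fin n) A) (Y : Matrix (Fin n) (Fin d) A) (h : X * Y = 1) :
    IsCompl (LinearMap.range X.vecMulLinear) (LinearMap.ker Y.vecMulLinear) := by
  have key : ∀ c, Y.vecMulLinear (X.vecMulLinear c) = c := fun c => by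
    simp [Matrix.vecMul_vecMul, h]
  constructor
  · rw [Submodule.disjoint_def]
    rintro _ ⟨c, rfl⟩ hc
    rw [LinearMap.mem_ker, key] at hc
    simp [hc]
  · rw [codisjoint_iff, eq_top_iff]
    intro v _
    refine Submodule.mem_sup.2 ⟨X.vecMulLinear (Y.vecMulLinear v), ⟨_, rfl⟩,
      v - X.vecMulLinear (Y.vecMulLinear v), ?_, by simp⟩
    rw [LinearMap.mem_ker, map_sub, key, sub_self]

lemma exists_rowSubmodule_compl (k : Type u) [Field k] {d n : ℕ} {A : Type u} [CommRing A]
    [Algebra k A] (X : Matrix (Fin d) (Fin n) A)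
    (hX : ∃ Y : Matrix (Fin n) (Fin d) A, X * Y = 1) :
    ∃ Q : Submodule A (Fin n → A), Nonempty (((A ⊗[k] (Fin n → k)) ⧸ rowSubmodule k X) ≃ₗ[A] Q) ∧
      Nonempty (((Fin d → A) × Q) ≃ₗ[A] (Fin n → A)) ∧ Module.Projective A Q := by
  obtain ⟨Y, hY⟩ := hX
  have hc := isCompl_rows X Y hY
  have e' : ((Fin d → A) × LinearMap.ker Y.vecMulLinear) ≃ₗ[A] (Fin n → A) := by
    refine LinearEquiv.prodCongr (LinearEquiv.ofInjective X.vecMulLinear ?_)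
      (LinearEquiv.refl A _) ≪≫ₗ Submodule.prodEquivOfIsCompl _ _ hc
    intro c c' hcc
    have := congrArg Y.vecMulLinear hcc
    simpa [Matrix.vecMul_vecMul, hY] using this
  refine ⟨LinearMap.ker Y.vecMulLinear, ⟨?_⟩, ⟨e'⟩, ?_⟩
  · refine (Submodule.Quotient.equiv _ _ (coord k n A) rfl).symm ≪≫ₗ ?_
    exact Submodule.quotientEquivOfIsCompl _ _ (by rw [span_rows_eq_range]; exact hc)
  · refine Module.Projective.of_split (M := Fin n → A)
      (e'.toLinearMap ∘ₗ LinearMap.inr A _ _) (LinearMap.snd A _ _ ∘ₗ e'.symm.toLinearMap) ?_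
    ext x; simp

/-- The point `[X]` of the Grassmannian given by the row span of a full-rank matrix `X`. -/
def rowPoint (k : Type u) [Field k] {d n : ℕ} {A : Type u} [CommRing A] [Algebra k A]
    (X : Matrix (Fin d) (Fin n) A) (hX : ∃ Y : Matrix (Fin n) (Fin d) A, X * Y = 1) :
    Module.Grassmannian A (A ⊗[k] (Fin n → k)) (n - d) where
  toSubmodule := rowSubmodule k X
  finite_quotient := inferInstance
  projective_quotient := by
    obtain ⟨Q, ⟨e⟩, -, hQ⟩ := exists_rowSubmodule_compl k X hX
    exact Module.Projective.of_equiv e.symm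
  rankAtStalk_eq p := by
    obtain ⟨Q, ⟨e⟩, ⟨e'⟩, hQ⟩ := exists_rowSubmodule_compl k X hX
    have : Module.Finite A Q := Module.Finite.equiv e
    have : Nontrivial A := p.nontrivial
    have h1 := congrFun (Module.rankAtStalk_eq_of_equiv e') p
    rw [Module.rankAtStalk_prod] at h1
    simp only [Pi.add_apply, Module.rankAtStalk_eq_finrank_of_free, Module.finrank_fin_fun,
      Pi.natCast_apply] at h1
    rw [Module.rankAtStalk_eq_of_equiv e]
    have h2 : (d : ℕ) + Module.rankAtStalk Q p = n := by simpa using h1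
    omega

lemma exists_eq_mul_of_span_eq {d n : ℕ} {A : Type u} [CommRing A]
    (X X' : Matrix (Fin d) (Fin n) A) (hX : ∃ Y : Matrix (Fin n) (Fin d) A, X * Y = 1)
    (h : Submodule.span A (Set.range fun i => X i) = Submodule.span A (Set.range fun i => X' i)) :
    ∃ g : GL (Fin d) A, X' = g.val * X := by
  have aux : ∀ X X' : Matrix (Fin d) (Fin n) A,
      Submodule.span A (Set.range fun i => X i) = Submodule.span A (Set.range fun i => X' i) →
      ∃ C : Matrix (Fin d) (Fin d) A, X' = C * X := by
    intro X X' h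
    have : ∀ i, ∃ c, X.vecMulLinear c = X' i := fun i => by
      have hi : X' i ∈ Submodule.span A (Set.range fun i => X' i) := Submodule.subset_span ⟨i, rfl⟩
      rw [← h, span_rows_eq_range] at hi
      exact hi
    choose C hC using this
    refine ⟨C, ?_⟩
    ext i j
    rw [← hC i]; rfl
  obtain ⟨C, hC⟩ := aux X X' h
  obtain ⟨C', hC'⟩ := aux X' X h.symm
  obtain ⟨Y, hY⟩ := hX
  have h1 : C' * C = 1 := by
    calc C' * C = (C' * (C * X)) * Y := by
          rw [Matrix.mul_assoc, Matrix.mul_assoc, hY, Matrix.mul_one]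
      _ = 1 := by rw [← hC, ← hC', hY]
  exact ⟨⟨C, C', mul_eq_one_comm.1 h1, h1⟩, hC⟩

lemma exists_eq_mul_of_rowSubmodule_eq {k : Type u} [Field k] {d n : ℕ} {A : Type u} [CommRing A]
    [Algebra k A] (X X' : Matrix (Fin d) (Fin n) A)
    (hX : ∃ Y : Matrix (Fin n) (Fin d) A, X * Y = 1)
    (h : rowSubmodule k X = rowSubmodule k X') : ∃ g : GL (Fin d) A, X' = g.val * X :=
  exists_eq_mul_of_span_eq X X' hX
    (Submodule.map_injective_of_injective (coord k n A).injective h)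

open Module.Grassmannian in
lemma map_rowPoint {k : Type u} [Field k] {d n : ℕ} {A B : Type u} [CommRing A] [CommRing B]
    [Algebra k A] [Algebra k B] (f : A →ₐ[k] B) (X : Matrix (Fin d) (Fin n) A)
    (hX : ∃ Y : Matrix (Fin n) (Fin d) A, X * Y = 1)
    (hX' : ∃ Y : Matrix (Fin n) (Fin d) B, X.map f * Y = 1) :
    Module.Grassmannian.map f (rowPoint k X hX) = rowPoint k (X.map f) hX' := by
  let _ : Algebra A B := f.toAlgebra
  have : IsScalarTower k A B := IsScalarTower.of_algebraMap_eq' f.comp_algebraMap.symm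
  have key0 : ∀ t : A ⊗[k] (Fin n → k), (coord k n B).symm
      (AlgebraTensorModule.cancelBaseChange k A B B (Fin n → k) (1 ⊗ₜ[A] t)) =
      fun j => f ((coord k n A).symm t j) := by
    intro t
    induction t with
    | zero => ext j; simp
    | add x y hx hy =>
      rw [TensorProduct.tmul_add, map_add, map_add, hx, hy]
      ext j; simp
    | tmul a m =>
      ext j
      simp only [coord, LinearEquiv.symm_symm, AlgebraTensorModule.cancelBaseChange_tmul,
        TensorProduct.piScalarRight_apply, TensorProduct.piScalarRightHom_tmul, map_smul]
      congr 1
      rw [Algebra.smul_def, mul_one]; rfl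
  have key : ∀ v : Fin n → A, AlgebraTensorModule.cancelBaseChange k A B B (Fin n → k)
      (1 ⊗ₜ[A] coord k n A v) = coord k n B (fun j => f (v j)) := by
    intro v
    rw [← LinearEquiv.symm_apply_eq, key0]
    simp
  have hrow : ∀ i, coord k n B ((X.map f) i) ∈ rowSubmodule k (X.map f) := fun i =>
    Submodule.mem_map_of_mem (Submodule.subset_span ⟨i, rfl⟩)
  ext : 1
  rw [map_toSubmodule]
  change (baseChangeMkQ B (rowSubmodule k X)).ker = rowSubmodule k (X.map f)
  apply le_antisymm
  · have hex := lTensor_mkQ (R := A) B (rowSubmodule k X)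
    have main : ∀ y : B ⊗[A] (A ⊗[k] (Fin n → k)),
        y ∈ LinearMap.range ((rowSubmodule k X).subtype.lTensor B) →
        AlgebraTensorModule.cancelBaseChange k A B B (Fin n → k) y ∈ rowSubmodule k (X.map f) := by
      rintro _ ⟨z, rfl⟩
      induction z with
      | zero => simp
      | add x y hx hy => rw [map_add, map_add]; exact add_mem hx hy
      | tmul b t =>
        obtain ⟨t, ht⟩ := t
        obtain ⟨v, hv, rfl⟩ := ht
        have e : (b ⊗ₜ[A] coord k n A v : B ⊗[A] (A ⊗[k] (Fin n → k))) =
            b • (1 ⊗ₜ[A] coord k n A v) := by simp [TensorProduct.smul_tmul']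
        rw [LinearMap.lTensor_tmul, Submodule.subtype_apply]
        change AlgebraTensorModule.cancelBaseChange k A B B (Fin n → k)
          (b ⊗ₜ[A] coord k n A v) ∈ _
        rw [e, map_smul, key]
        clear e
        refine Submodule.smul_mem _ _ ?_
        refine Submodule.mem_map_of_mem ?_
        induction hv using Submodule.span_induction with
        | mem x h => obtain ⟨i, rfl⟩ := h; exact Submodule.subset_span ⟨i, rfl⟩
        | zero =>
          have : (fun j => f ((0 : Fin n → A) j)) = (0 : Fin n → B) := by ext; simp
          rw [this]; exact zero_mem _
        | add x y _ _ hx hy =>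
          have : (fun j => f ((x + y) j)) = (fun j => f (x j)) + (fun j => f (y j)) := by
            ext; simp
          rw [this]; exact add_mem hx hy
        | smul a x _ hx =>
          have : (fun j => f ((a • x) j)) = f a • (fun j => f (x j)) := by ext; simp
          rw [this]; exact Submodule.smul_mem _ _ hx
    intro x hx
    have h1 : (AlgebraTensorModule.cancelBaseChange k A B B (Fin n → k)).symm x ∈
        LinearMap.range ((rowSubmodule k X).subtype.lTensor B) := by
      rw [← hex]; exact hx
    simpa using main _ h1
  · rw [rowSubmodule, Submodule.map_span, Submodule.span_le]
    rintro _ ⟨_, ⟨i, rfl⟩, rfl⟩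
    have h2 : coord k n B ((X.map f) i) = AlgebraTensorModule.cancelBaseChange k A B B
      (Fin n → k) (1 ⊗ₜ[A] coord k n A (X i)) := (key (X i)).symm
    have h3 : (rowSubmodule k X).mkQ (coord k n A (X i)) = 0 := by
      rw [Submodule.mkQ_apply, Submodule.Quotient.mk_eq_zero]
      exact Submodule.mem_map_of_mem (Submodule.subset_span ⟨i, rfl⟩)
    change baseChangeMkQ B (rowSubmodule k X) (coord k n B ((X.map f) i)) = 0
    rw [h2]
    simp [baseChangeMkQ, h3]

/-- The morphism `[_] : V_{d,n} → Gr(d,n)` sending a full-rank matrix to its row span. -/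
def rowSpan (k : Type u) [Field k] (d n : ℕ) : (fullRank k d n).toFunctor ⟶ gr k d n where
  app A := ↾fun X => rowPoint k X.1 X.2
  naturality A B f := by
    ext X
    exact (map_rowPoint f.hom X.1 X.2 ((fullRank k d n).map f X.2)).symm

/-! ### Subgroups of the general linear group -/

/-- Upper triangular invertible matrices. -/
def borel (m : ℕ) (A : Type u) [CommRing A] : Set (GL (Fin m) A) :=
  {g | ∀ i j, j < i → g i j = 0}

/-- Lower triangular invertible matrices. -/
def oppBorel (m : ℕ) (A : Type u) [CommRing A] : Set (GL (Fin m) A) :=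
  {g | ∀ i j, i < j → g i j = 0}

/-- The unipotent radical of the upper triangular Borel. -/
def unip (m : ℕ) (A : Type u) [CommRing A] : Set (GL (Fin m) A) :=
  {g | g ∈ borel m A ∧ ∀ i, g i i = 1}

/-- The unipotent radical of the lower triangular Borel. -/
def oppUnip (m : ℕ) (A : Type u) [CommRing A] : Set (GL (Fin m) A) :=
  {g | g ∈ oppBorel m A ∧ ∀ i, g i i = 1}

/-- The maximal torus of diagonal matrices. -/
def torus (m : ℕ) (A : Type u) [CommRing A] : Set (GL (Fin m) A) :=
  {g | ∀ i j, i ≠ j → g i j = 0}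

/-- The permutation matrix of `w`: it maps the `l`-th standard basis vector to the `w l`-th. -/
def permGL {m : ℕ} (A : Type u) [CommRing A] (w : Equiv.Perm (Fin m)) : GL (Fin m) A where
  val := Matrix.of fun i j => if i = w j then 1 else 0
  inv := Matrix.of fun i j => if w i = j then 1 else 0
  val_inv := by
    ext i j
    rw [Matrix.mul_apply, Finset.sum_eq_single (w.symm i)] <;>
      simp +contextual [Matrix.one_apply, Equiv.eq_symm_apply, eq_comm]
  inv_val := by
    ext i j
    rw [Matrix.mul_apply, Finset.sum_eq_single (w i)] <;>
      simp +contextual [Matrix.one_apply, eq_comm]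

/-- `U⁻_w = U⁻ ∩ w⁻¹ U⁻ w`. -/
def oppUnipW {m : ℕ} (A : Type u) [CommRing A] (w : Equiv.Perm (Fin m)) : Set (GL (Fin m) A) :=
  {g | g ∈ oppUnip m A ∧ permGL A w * g * (permGL A w)⁻¹ ∈ oppUnip m A}

section basechange_of_rings

variable {A B : Type u} [CommRing A] [CommRing B] (f : A →+* B) {m : ℕ}

open Matrix.GeneralLinearGroup

lemma map_permGL (w : Equiv.Perm (Fin m)) : map f (permGL A w) = permGL B w := by
  ext i j
  change f (if i = w j then 1 else 0) = if i = w j then 1 else 0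
  split_ifs <;> simp

lemma map_borel {g : GL (Fin m) A} (h : g ∈ borel m A) : map f g ∈ borel m B := fun i j hij => by
  rw [Matrix.GeneralLinearGroup.map_apply, h i j hij, _root_.map_zero]

lemma map_oppBorel {g : GL (Fin m) A} (h : g ∈ oppBorel m A) : map f g ∈ oppBorel m B :=
  fun i j hij => by rw [Matrix.GeneralLinearGroup.map_apply, h i j hij, _root_.map_zero]

lemma map_unip {g : GL (Fin m) A} (h : g ∈ unip m A) : map f g ∈ unip m B :=
  ⟨map_borel f h.1, fun i => by rw [Matrix.GeneralLinearGroup.map_apply, h.2 i, _root_.map_one]⟩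

lemma map_oppUnip {g : GL (Fin m) A} (h : g ∈ oppUnip m A) : map f g ∈ oppUnip m B :=
  ⟨map_oppBorel f h.1, fun i => by rw [Matrix.GeneralLinearGroup.map_apply, h.2 i, _root_.map_one]⟩

lemma map_torus {g : GL (Fin m) A} (h : g ∈ torus m A) : map f g ∈ torus m B :=
  fun i j hij => by rw [Matrix.GeneralLinearGroup.map_apply, h i j hij, _root_.map_zero]

lemma map_oppUnipW {w : Equiv.Perm (Fin m)} {g : GL (Fin m) A} (h : g ∈ oppUnipW A w) :
    map f g ∈ oppUnipW B w := by
  refine ⟨map_oppUnip f h.1, ?_⟩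
  have := map_oppUnip f h.2
  rwa [_root_.map_mul, _root_.map_mul, _root_.map_inv, map_permGL] at this

end basechange_of_rings

/-- The double coset `B w B⁻ ⊆ GL_d`. (Multiplication `U × w T U⁻_w → B w B⁻` is an isomorphism,
so that no sheafification is needed in this description of the points.) -/
def bruhatCell (k : Type u) [Field k] {d : ℕ} (w : Equiv.Perm (Fin d)) :
    Subfunctor (glFunctor k d) where
  obj A := {g : GL (Fin d) A | ∃ b ∈ borel d A, ∃ c ∈ oppBorel d A, g = b * permGL A w * c}
  map {A B} f := by
    rintro _ ⟨b, hb, c, hc, rfl⟩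
    refine ⟨_, map_borel f.hom.toRingHom hb, _, map_oppBorel f.hom.toRingHom hc, ?_⟩
    rw [← map_permGL f.hom.toRingHom, ← map_mul, ← map_mul]
    rfl

/-! ### Schubert cells and open Richardson varieties

A subset `I = {i_1 < ⋯ < i_d}` of `{1, …, n}` is given by its increasing enumeration
`I : Fin d ↪o Fin n`. -/

/-- The matrix `e_I`, whose `a`-th row is the `i_a`-th standard basis vector. -/
def eMat {d n : ℕ} (A : Type u) [CommRing A] (I : Fin d ↪o Fin n) : Matrix (Fin d) (Fin n) A :=
  Matrix.of fun a l => if l = I a then 1 else 0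

/-- The action of `g ∈ GL_n(A)` on `A ⊗ k^n`, i.e. `v ↦ v gᵀ` on row vectors. -/
def gAct (k : Type u) [Field k] {n : ℕ} {A : Type u} [CommRing A] [Algebra k A]
    (g : GL (Fin n) A) : A ⊗[k] (Fin n → k) →ₗ[A] A ⊗[k] (Fin n → k) :=
  (coord k n A).toLinearMap ∘ₗ g.val.mulVecLin ∘ₗ (coord k n A).symm.toLinearMap

lemma map_gAct_rowSubmodule {k : Type u} [Field k] {d n : ℕ} {A : Type u} [CommRing A]
    [Algebra k A] (g : GL (Fin n) A) (X : Matrix (Fin d) (Fin n) A) :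
    (rowSubmodule k X).map (gAct k g) = rowSubmodule k (X * g.val.transpose) := by
  unfold rowSubmodule gAct
  rw [← Submodule.map_comp, LinearMap.comp_assoc, LinearMap.comp_assoc,
    LinearEquiv.comp_coe, LinearEquiv.self_trans_symm]
  simp only [LinearEquiv.refl_toLinearMap, LinearMap.comp_id]
  rw [Submodule.map_comp, Submodule.map_span, ← Set.range_comp]
  congr 3
  funext i
  simp [Matrix.mul_apply_eq_vecMul, Matrix.vecMul_transpose]

lemma map_eMat {A B : Type u} [CommRing A] [CommRing B] (f : A →+* B) {d n : ℕ}
    (I : Fin d ↪o Fin n) : (eMat A I).map f = eMat B I := by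
  ext i j
  change f (if j = I i then 1 else 0) = if j = I i then 1 else 0
  split_ifs <;> simp

lemma eMat_mul_fullRank {A : Type u} [CommRing A] {d n : ℕ} (I : Fin d ↪o Fin n)
    (g : GL (Fin n) A) :
    ∃ Y : Matrix (Fin n) (Fin d) A, (eMat A I * g.val.transpose) * Y = 1 := by
  refine ⟨(g⁻¹).val.transpose * (eMat A I).transpose, ?_⟩
  rw [Matrix.mul_assoc, ← Matrix.mul_assoc g.val.transpose, ← Matrix.transpose_mul,
    Units.inv_mul, Matrix.transpose_one, Matrix.one_mul]
  ext i j
  simp [Matrix.mul_apply, eMat, Matrix.one_apply, eq_comm]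

lemma map_orbit {k : Type u} [Field k] {d n : ℕ} {A B : CommAlgCat.{u} k} (f : A ⟶ B)
    (I : Fin d ↪o Fin n) (W : (gr k d n).obj A) (g : GL (Fin n) A)
    (hW : W.toSubmodule = (rowSubmodule k (eMat A I)).map (gAct k g)) :
    ((gr k d n).map f W).toSubmodule = (rowSubmodule k (eMat B I)).map
      (gAct k (Matrix.GeneralLinearGroup.map f.hom.toRingHom g)) := by
  rw [map_gAct_rowSubmodule] at hW ⊢
  have h0 := eMat_mul_fullRank I g
  have hW' : W = rowPoint k _ h0 := Module.Grassmannian.ext hW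
  have h1 : (eMat A I * g.val.transpose).map f.hom = eMat B I *
      (Matrix.GeneralLinearGroup.map f.hom.toRingHom g).val.transpose := by
    rw [Matrix.map_mul, ← map_eMat f.hom.toRingHom]; rfl
  subst hW'
  have h2 := map_rowPoint f.hom _ h0 (by rw [h1]; exact eMat_mul_fullRank I _)
  change (Module.Grassmannian.map f.hom _).toSubmodule = _
  rw [← h1, h2]; rfl

/-- The Bruhat cell `Z_I^- = B⁻ · [e_I]` (`B⁻ ⊆ GL_n` lower triangular). (The orbit map has a
section over the cell, so every point over `A` is of the form `g · [e_I]` with `g ∈ B⁻(A)`.) -/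
def schubertMinus (k : Type u) [Field k] {d n : ℕ} (I : Fin d ↪o Fin n) :
    Subfunctor (gr k d n) where
  obj A := {W : Module.Grassmannian A (A ⊗[k] (Fin n → k)) (n - d) |
    ∃ g ∈ oppBorel n A, W.toSubmodule = (rowSubmodule k (eMat A I)).map (gAct k g)}
  map {A B} f := by
    rintro W ⟨g, hg, hW⟩
    exact ⟨_, map_oppBorel f.hom.toRingHom hg, map_orbit f I W g hW⟩

/-- The Bruhat cell `Z_J^+ = B · [e_J]` (`B ⊆ GL_n` upper triangular). -/
def schubertPlus (k : Type u) [Field k] {d n : ℕ} (J : Fin d ↪o Fin n) :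
    Subfunctor (gr k d n) where
  obj A := {W : Module.Grassmannian A (A ⊗[k] (Fin n → k)) (n - d) |
    ∃ g ∈ borel n A, W.toSubmodule = (rowSubmodule k (eMat A J)).map (gAct k g)}
  map {A B} f := by
    rintro W ⟨g, hg, hW⟩
    exact ⟨_, map_borel f.hom.toRingHom hg, map_orbit f J W g hW⟩

/-- The open Richardson variety `Z_I^- ∩ Z_J^+`. -/
def richardson (k : Type u) [Field k] {d n : ℕ} (I J : Fin d ↪o Fin n) : Subfunctor (gr k d n) :=
  schubertMinus k I ⊓ schubertPlus k J

/-! ### The base change map -/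

/-- The columns of `X` indexed by `I`. -/
def cols {d n : ℕ} {A : Type u} (X : Matrix (Fin d) (Fin n) A) (I : Fin d ↪o Fin n) :
    Matrix (Fin d) (Fin d) A :=
  X.submatrix id I

lemma cols_mul {d n : ℕ} {A : Type u} [CommRing A] (g : Matrix (Fin d) (Fin d) A)
    (X : Matrix (Fin d) (Fin n) A) (I : Fin d ↪o Fin n) : cols (g * X) I = g * cols X I := by
  ext i j; simp [cols, Matrix.mul_apply]

lemma cols_eMat_mul {d n : ℕ} {A : Type u} [CommRing A] (I : Fin d ↪o Fin n)
    (M : Matrix (Fin n) (Fin n) A) : cols (eMat A I * M.transpose) I =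
      (M.submatrix I I).transpose := by
  ext i j; simp [cols, Matrix.mul_apply, eMat]

lemma isUnit_det_of_isUnit_diag {m : ℕ} {A : Type u} [CommRing A] {g : GL (Fin m) A}
    (h : g.val.det = ∏ i, g i i) (i : Fin m) : IsUnit (g i i) := by
  have h1 : IsUnit g.val.det := (Matrix.isUnit_iff_isUnit_det _).1 g.isUnit
  rw [h] at h1
  exact isUnit_of_dvd_unit (Finset.dvd_prod_of_mem (fun i => g i i) (Finset.mem_univ i)) h1

lemma isUnit_cols_of_lower {d n : ℕ} {A : Type u} [CommRing A] (I : Fin d ↪o Fin n)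
    {g : GL (Fin n) A} (hg : g ∈ oppBorel n A) :
    IsUnit (cols (eMat A I * g.val.transpose) I).det := by
  have h : g.val.det = ∏ i, g i i := Matrix.det_of_isLowerTriangular _ fun i j hij => hg i j hij
  rw [cols_eMat_mul, Matrix.det_transpose,
    Matrix.det_of_isLowerTriangular (g.val.submatrix I I) fun i j hij =>
      hg _ _ (I.lt_iff_lt.2 hij),
    IsUnit.prod_univ_iff]
  exact fun i => isUnit_det_of_isUnit_diag h _

lemma isUnit_cols_of_upper {d n : ℕ} {A : Type u} [CommRing A] (I : Fin d ↪o Fin n)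
    {g : GL (Fin n) A} (hg : g ∈ borel n A) :
    IsUnit (cols (eMat A I * g.val.transpose) I).det := by
  have h : g.val.det = ∏ i, g i i := Matrix.det_of_isUpperTriangular fun i j hij => hg i j hij
  rw [cols_eMat_mul, Matrix.det_transpose,
    Matrix.det_of_isUpperTriangular (M := g.val.submatrix I I) fun i j hij =>
      hg _ _ (I.lt_iff_lt.2 hij),
    IsUnit.prod_univ_iff]
  exact fun i => isUnit_det_of_isUnit_diag h _

lemma isUnit_cols {k : Type u} [Field k] {d n : ℕ} {I J : Fin d ↪o Fin n} {A : CommAlgCat.{u} k}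
    {W : (gr k d n).obj A} (hW : W ∈ (richardson k I J).obj A)
    {X : Matrix (Fin d) (Fin n) A} (hX : ∃ Y : Matrix (Fin n) (Fin d) A, X * Y = 1)
    (hXW : rowPoint k X hX = W) : IsUnit (cols X I).det ∧ IsUnit (cols X J).det := by
  obtain ⟨⟨g, hg, h1⟩, ⟨g', hg', h2⟩⟩ := hW
  subst hXW
  rw [map_gAct_rowSubmodule] at h1 h2
  obtain ⟨c, hc⟩ := exists_eq_mul_of_rowSubmodule_eq _ _ (eMat_mul_fullRank I g) h1.symm
  obtain ⟨c', hc'⟩ := exists_eq_mul_of_rowSubmodule_eq _ _ (eMat_mul_fullRank J g') h2.symm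
  constructor
  · rw [hc, cols_mul, Matrix.det_mul]
    exact ((Matrix.isUnit_iff_isUnit_det _).1 c.isUnit).mul (isUnit_cols_of_lower I hg)
  · rw [hc', cols_mul, Matrix.det_mul]
    exact ((Matrix.isUnit_iff_isUnit_det _).1 c'.isUnit).mul (isUnit_cols_of_upper J hg')

lemma exists_rowPoint_eq {k : Type u} [Field k] {d n : ℕ} {I J : Fin d ↪o Fin n}
    {A : CommAlgCat.{u} k} {W : (gr k d n).obj A} (hW : W ∈ (richardson k I J).obj A) :
    ∃ (X : Matrix (Fin d) (Fin n) A) (hX : ∃ Y : Matrix (Fin n) (Fin d) A, X * Y = 1),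
      rowPoint k X hX = W := by
  obtain ⟨⟨g, hg, h1⟩, -⟩ := hW
  rw [map_gAct_rowSubmodule] at h1
  exact ⟨_, eMat_mul_fullRank I g, Module.Grassmannian.ext h1.symm⟩

/-- The base change matrix `(X_I)⁻¹ X_J` of a point `W = [X]` of the open Richardson variety. -/
def baseChangePt {k : Type u} [Field k] {d n : ℕ} {I J : Fin d ↪o Fin n} {A : CommAlgCat.{u} k}
    (W : (richardson k I J).toFunctor.obj A) : GL (Fin d) A :=
  let X := (exists_rowPoint_eq W.2).choose
  have h := isUnit_cols W.2 _ (exists_rowPoint_eq W.2).choose_spec.choose_spec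
  (Matrix.GeneralLinearGroup.mk'' (cols X I) h.1)⁻¹ * Matrix.GeneralLinearGroup.mk'' (cols X J) h.2

/-- The base change matrix does not depend on the representing matrix `X`. -/
lemma baseChangePt_unique {k : Type u} [Field k] {d n : ℕ} {I J : Fin d ↪o Fin n}
    {A : CommAlgCat.{u} k} (W : (richardson k I J).toFunctor.obj A)
    (X : Matrix (Fin d) (Fin n) A) (hX : ∃ Y : Matrix (Fin n) (Fin d) A, X * Y = 1)
    (hXW : rowPoint k X hX = W.1) (c : GL (Fin d) A) :
    baseChangePt W = c ↔ cols X I * c.val = cols X J := by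
  have h := isUnit_cols W.2 _ (exists_rowPoint_eq W.2).choose_spec.choose_spec
  obtain ⟨g, hg⟩ := exists_eq_mul_of_rowSubmodule_eq (k := k) _ X
    (exists_rowPoint_eq W.2).choose_spec.choose
    (congrArg Module.Grassmannian.toSubmodule
      ((exists_rowPoint_eq W.2).choose_spec.choose_spec.trans hXW.symm))
  have e : baseChangePt W = (Matrix.GeneralLinearGroup.mk'' _ h.1)⁻¹ *
    Matrix.GeneralLinearGroup.mk'' _ h.2 := rfl
  rw [e, inv_mul_eq_iff_eq_mul, hg, cols_mul, cols_mul, Matrix.mul_assoc, Units.ext_iff]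
  refine ⟨fun h => ?_, fun h => ?_⟩
  · exact congrArg (g.val * ·) h.symm
  · have := congrArg (g⁻¹.val * ·) h
    simp only [← Matrix.mul_assoc, Units.inv_mul, Matrix.one_mul] at this
    exact this.symm

/-- The base change map from the open Richardson variety to `GL_d`. -/
def baseChange (k : Type u) [Field k] {d n : ℕ} (I J : Fin d ↪o Fin n) :
    (richardson k I J).toFunctor ⟶ glFunctor k d where
  app A := ↾fun W => baseChangePt W
  naturality A B f := by
    ext W
    obtain ⟨X, hX, hXW⟩ := exists_rowPoint_eq W.2
    have hX' := (fullRank k d n).map f hX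
    have h1 := (baseChangePt_unique W X hX hXW _).1 rfl
    refine (baseChangePt_unique _ (X.map f.hom) hX' ?_ _).2 ?_
    · rw [← map_rowPoint f.hom X hX hX', hXW]; rfl
    · have h2 := congrArg (fun M => M.map f.hom) h1
      exact Matrix.map_mul.symm.trans h2

/-- The stratum of the open Richardson variety: the preimage of `B w B⁻` under base change. -/
def stratum (k : Type u) [Field k] {d n : ℕ} (I J : Fin d ↪o Fin n) (w : Equiv.Perm (Fin d)) :
    Subfunctor (richardson k I J).toFunctor :=
  (bruhatCell k w).preimage (baseChange k I J)

/-! ### The hybrid normal form -/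

/-- `M_I^-`: the columns `I` form the identity, and zeros to the left of the leading entries. -/
def mMinus {d n : ℕ} (A : Type u) [CommRing A] (I : Fin d ↪o Fin n) :
    Set (Matrix (Fin d) (Fin n) A) :=
  {X | cols X I = 1 ∧ ∀ a l, l < I a → X a l = 0}

/-- `M_J^+`: the columns `J` form the identity, and zeros to the right of the leading entries. -/
def mPlus {d n : ℕ} (A : Type u) [CommRing A] (J : Fin d ↪o Fin n) :
    Set (Matrix (Fin d) (Fin n) A) :=
  {X | cols X J = 1 ∧ ∀ a l, J a < l → X a l = 0}

lemma map_cols {A B : Type u} [CommRing A] [CommRing B] (f : A →+* B) {d n : ℕ}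
    {I : Fin d ↪o Fin n} {X : Matrix (Fin d) (Fin n) A} (h : cols X I = 1) :
    cols (X.map f) I = 1 := by
  have := congrArg (fun M => M.map f) h
  rw [Matrix.map_one _ (map_zero f) (map_one f)] at this
  exact this

lemma map_mMinus {A B : Type u} [CommRing A] [CommRing B] (f : A →+* B) {d n : ℕ}
    {I : Fin d ↪o Fin n} {X : Matrix (Fin d) (Fin n) A} (h : X ∈ mMinus A I) :
    X.map f ∈ mMinus B I :=
  ⟨map_cols f h.1, fun a l hl => by rw [Matrix.map_apply, h.2 a l hl, map_zero]⟩

lemma map_mPlus {A B : Type u} [CommRing A] [CommRing B] (f : A →+* B) {d n : ℕ}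
    {I : Fin d ↪o Fin n} {X : Matrix (Fin d) (Fin n) A} (h : X ∈ mPlus A I) :
    X.map f ∈ mPlus B I :=
  ⟨map_cols f h.1, fun a l hl => by rw [Matrix.map_apply, h.2 a l hl, map_zero]⟩

/-- The hybrid normal form `U M_I^- ∩ w T U⁻_w M_J^+`. -/
def hybrid (k : Type u) [Field k] {d n : ℕ} (I J : Fin d ↪o Fin n) (w : Equiv.Perm (Fin d)) :
    Subfunctor (matFunctor k d n) where
  obj A := {X : Matrix (Fin d) (Fin n) A |
    (∃ u ∈ unip d A, ∃ Y ∈ mMinus A I, X = u.val * Y) ∧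
    (∃ t ∈ torus d A, ∃ l ∈ oppUnipW A w, ∃ Y ∈ mPlus A J, X = (permGL A w * t * l).val * Y)}
  map {A B} f := by
    rintro X ⟨⟨u, hu, Y, hY, h1⟩, ⟨t, ht, l, hl, Y', hY', h2⟩⟩
    refine ⟨⟨_, map_unip f.hom.toRingHom hu, _, map_mMinus f.hom.toRingHom hY, ?_⟩,
      ⟨_, map_torus f.hom.toRingHom ht, _, map_oppUnipW f.hom.toRingHom hl, _,
        map_mPlus f.hom.toRingHom hY', ?_⟩⟩
    · exact (congrArg (fun M => M.map f.hom) h1).trans Matrix.map_mul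
    · rw [← map_permGL f.hom.toRingHom, ← map_mul, ← map_mul]
      exact (congrArg (fun M => M.map f.hom) h2).trans Matrix.map_mul

lemma hybrid_le_fullRank (k : Type u) [Field k] {d n : ℕ} (I J : Fin d ↪o Fin n)
    (w : Equiv.Perm (Fin d)) : hybrid k I J w ≤ fullRank k d n := by
  rintro A X ⟨⟨u, hu, Y, hY, h1⟩, -⟩
  refine ⟨(eMat A I).transpose * (u⁻¹).val, ?_⟩
  have h2 : Y * (eMat A I).transpose = 1 := by
    rw [← hY.1]
    ext i j
    simp [cols, Matrix.mul_apply, eMat]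
  rw [h1, Matrix.mul_assoc, ← Matrix.mul_assoc Y, h2, Matrix.one_mul, Units.mul_inv]

/-! ### Lengths and the target variety -/

/-- The length of a permutation: its number of inversions. -/
def permLength {m : ℕ} (v : Equiv.Perm (Fin m)) : ℕ :=
  (Finset.univ.filter fun p : Fin m × Fin m => p.1 < p.2 ∧ v p.2 < v p.1).card

/-- The length of a `d`-subset `I` of `{1, …, n}`: the length of a shortest permutation
`v ∈ S_n` with `v({1, …, d}) = I`. -/
def subsetLength {d n : ℕ} (I : Fin d ↪o Fin n) : ℕ :=
  sInf {m | ∃ v : Equiv.Perm (Fin n), v '' {l | l.val < d} = Set.range I ∧ permLength v = m}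

/-- The variety `𝔾_m^α × 𝔸^β`, as a functor of points. -/
def gmAffine (k : Type u) [Field k] (α β : ℕ) : CommAlgCat.{u} k ⥤ Type u where
  obj A := (Fin α → Aˣ) × (Fin β → A)
  map f := ↾fun p => (fun i => Units.map (f.hom : _ →* _) (p.1 i), fun i => f.hom (p.2 i))
  map_id A := by ext p <;> rfl
  map_comp f g := by ext p <;> rfl

end

end GaussDecomposition

open CategoryTheory TensorProduct

namespace GaussDecomposition

universe u

/-! ### Triangular matrices over a ring and the decomposition `B w B⁻ = U w T U⁻_w`. -/

section Triangular

variable {A : Type u} [CommRing A]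

/-! Over any commutative ring, every element of `B w B⁻` factors as `u₀ · (w t l)` with `u₀ ∈ U`, `t
∈ T`, `l ∈ U⁻_w` (`exists_gauss_decomposition`). A point of the stratum is the row span of some `X`
with `X_I⁻¹ X_J = u₀ w t l`. Rescaling by `GL_d` so that `X_I = u₀⁻¹` and `X_J = w t l` puts `X` in
the hybrid normal form (`exists_hybrid_of_mem_stratum`). Two such representatives of one point
differ by some `g ∈ GL_d`; comparing the columns `I` gives `g ∈ U`, comparing the columns `J` gives
`g ∈ B⁻`, hence `g = 1` (`eq_of_rowSubmodule_eq`). So the row span map is bijective on points over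
every algebra, which is (a).

Since `X = uY` with `Y_I = 1` forces `u = X_I`, and likewise for `J`, the hybrid normal form is cut
out by conditions on single entries (`mem_hybrid_iff`). Row `w a` vanishes left of column `I (w a)`
and right of column `J a`, has `1` at `I (w a)` and a unit at `J a`, and vanishes at `J b` for every
inversion `b < a`, `w a < w b`. If `J a < I (w a)`, an entry is both `1` and `0`, which is
impossible over a nonzero ring. If `I (w a) ≤ J a` for all `a`, the conditions are compatible, and
the remaining entries are arbitrary: this gives (b) and the product structure in (c).

The exponents come from counting in each row: the `J a - I (w a)` columns after `I (w a)` up to `J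
a` are free, or carry a unit, or are cleared by an inversion (`card_row_eq`). Summing over rows,
with `ℓ(I) = ∑ (I a - a)` (`subsetLength_eq_sum`), yields `card_freePositions`.

Upper and lower triangular matrices, and the two kinds of Schubert cells, are treated together
through an injective `b` into a linear order, specialized to `id` and to `OrderDual.toDual`. -/

lemma det_eq_prod_of_blockTriangular {m α : Type*} [Fintype m] [DecidableEq m] [LinearOrder α]
    {b : m → α} (hb : Function.Injective b) {M : Matrix m m A} (h : M.BlockTriangular b) :
    M.det = ∏ i, M i i := by
  -- For the order pulled back along `b`, block triangular means upper triangular.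
  let _ : LinearOrder m := LinearOrder.lift' b hb
  exact Matrix.det_of_isUpperTriangular h

lemma blockTriangular_mul_apply_diag {m α : Type*} [Fintype m] [LinearOrder α]
    {b : m → α} (hb : Function.Injective b) {M N : Matrix m m A} (hM : M.BlockTriangular b)
    (hN : N.BlockTriangular b) (i : m) : (M * N) i i = M i i * N i i := by
  rw [Matrix.mul_apply]
  refine Finset.sum_eq_single i (fun j _ hj => ?_) (by simp)
  rcases lt_or_gt_of_ne (hb.ne hj) with h | h
  · rw [hM h, zero_mul]
  · rw [hN h, mul_zero]

lemma blockTriangular_inv {m α : Type*} [Fintype m] [DecidableEq m] [LinearOrder α]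
    {b : m → α} {g : GL m A} (h : g.val.BlockTriangular b) : (g⁻¹).val.BlockTriangular b := by
  let _ : Invertible g.val := g.invertible
  rw [Matrix.coe_units_inv]
  exact Matrix.blockTriangular_inv_of_blockTriangular h

lemma inv_apply_diag {m α : Type*} [Fintype m] [DecidableEq m] [LinearOrder α]
    {b : m → α} (hb : Function.Injective b) {g : GL m A} (h : g.val.BlockTriangular b)
    (h1 : ∀ i, g i i = 1) (i : m) : (g⁻¹).val i i = 1 := by
  have h2 := blockTriangular_mul_apply_diag hb h (blockTriangular_inv h) i
  rw [Units.mul_inv, Matrix.one_apply_eq] at h2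
  have h3 : g.val i i = 1 := h1 i
  rw [h3, one_mul] at h2
  exact h2.symm

variable {m : ℕ}

lemma borel_mul {g h : GL (Fin m) A} (hg : g ∈ borel m A) (hh : h ∈ borel m A) :
    g * h ∈ borel m A :=
  Matrix.BlockTriangular.mul (b := id) (M := g.val) (N := h.val) (fun i j => hg i j)
    (fun i j => hh i j)

lemma borel_inv {g : GL (Fin m) A} (hg : g ∈ borel m A) : g⁻¹ ∈ borel m A :=
  fun _ _ hij => blockTriangular_inv (b := id) (g := g) (fun i j => hg i j) hij

lemma oppBorel_mul {g h : GL (Fin m) A} (hg : g ∈ oppBorel m A) (hh : h ∈ oppBorel m A) :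
    g * h ∈ oppBorel m A := fun _ _ hij =>
  Matrix.BlockTriangular.mul (b := OrderDual.toDual) (M := g.val) (N := h.val) (fun i j => hg i j)
    (fun i j => hh i j) hij

lemma oppBorel_inv {g : GL (Fin m) A} (hg : g ∈ oppBorel m A) : g⁻¹ ∈ oppBorel m A :=
  fun _ _ hij => blockTriangular_inv (b := OrderDual.toDual) (g := g) (fun i j => hg i j) hij

lemma unip_mul {g h : GL (Fin m) A} (hg : g ∈ unip m A) (hh : h ∈ unip m A) :
    g * h ∈ unip m A :=
  ⟨borel_mul hg.1 hh.1, fun i =>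
    (blockTriangular_mul_apply_diag (b := id) Function.injective_id (M := g.val) (N := h.val)
      (fun i j => hg.1 i j) (fun i j => hh.1 i j) i).trans (by
        have h1 := hg.2 i
        have h2 := hh.2 i
        rw [h1, h2, one_mul])⟩

lemma unip_inv {g : GL (Fin m) A} (hg : g ∈ unip m A) : g⁻¹ ∈ unip m A :=
  ⟨borel_inv hg.1, inv_apply_diag (b := id) Function.injective_id (fun i j => hg.1 i j) hg.2⟩

lemma isUnit_diag_of_mem_borel {g : GL (Fin m) A} (hg : g ∈ borel m A) (i : Fin m) :
    IsUnit (g i i) :=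
  isUnit_det_of_isUnit_diag (det_eq_prod_of_blockTriangular (b := id) Function.injective_id
    (fun i j => hg i j)) i

lemma isUnit_diag_of_mem_oppBorel {g : GL (Fin m) A} (hg : g ∈ oppBorel m A) (i : Fin m) :
    IsUnit (g i i) :=
  isUnit_det_of_isUnit_diag (det_eq_prod_of_blockTriangular (b := OrderDual.toDual)
    OrderDual.toDual.injective (fun i j => hg i j)) i

/-- The diagonal matrix with given units on the diagonal. -/
def diagGL (v : Fin m → Aˣ) : GL (Fin m) A where
  val := Matrix.diagonal fun i => (v i : A)
  inv := Matrix.diagonal fun i => ((v i)⁻¹ : Aˣ)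
  val_inv := by simp
  inv_val := by simp

lemma diagGL_mul_apply {n : ℕ} (v : Fin m → Aˣ) (M : Matrix (Fin m) (Fin n) A) (i : Fin m)
    (j : Fin n) : ((diagGL v).val * M) i j = v i * M i j :=
  Matrix.diagonal_mul _ _ _ _

lemma mul_diagGL_inv_apply (v : Fin m → Aˣ) (M : Matrix (Fin m) (Fin m) A) (i j : Fin m) :
    (M * ((diagGL v)⁻¹).val) i j = M i j * ((v j)⁻¹ : Aˣ) :=
  Matrix.mul_diagonal _ _ _ _

lemma diagGL_inv_mul_apply (v : Fin m → Aˣ) (M : Matrix (Fin m) (Fin m) A) (i j : Fin m) :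
    (((diagGL v)⁻¹).val * M) i j = ((v i)⁻¹ : Aˣ) * M i j :=
  Matrix.diagonal_mul _ _ _ _

lemma diagGL_mem_torus (v : Fin m → Aˣ) : diagGL v ∈ torus m A := fun _ _ hij =>
  Matrix.diagonal_apply_ne _ hij

lemma permGL_mul_apply {n : ℕ} (w : Equiv.Perm (Fin m)) (M : Matrix (Fin m) (Fin n) A)
    (i : Fin m) (j : Fin n) : ((permGL A w).val * M) (w i) j = M i j := by
  rw [Matrix.mul_apply, Finset.sum_eq_single i] <;>
    simp +contextual [permGL, eq_comm]

lemma mul_permGL_inv_apply (w : Equiv.Perm (Fin m)) (M : Matrix (Fin m) (Fin m) A)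
    (i j : Fin m) : (M * ((permGL A w)⁻¹).val) i (w j) = M i j := by
  change (M * (Matrix.of fun i j => if w i = j then 1 else 0 : Matrix (Fin m) (Fin m) A)) i (w j) =
    M i j
  rw [Matrix.mul_apply, Finset.sum_eq_single j] <;> simp +contextual

/-- Conjugation by `w` only relabels rows and columns. This turns membership in `U⁻_w` into the
vanishing of individual entries. -/
lemma permGL_conj_apply (w : Equiv.Perm (Fin m)) (g : GL (Fin m) A) (i j : Fin m) :
    (permGL A w * g * (permGL A w)⁻¹) (w i) (w j) = g i j := by
  change (((permGL A w).val * g.val) * ((permGL A w)⁻¹).val) (w i) (w j) = _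
  rw [mul_permGL_inv_apply, permGL_mul_apply]

lemma permGL_conj_mem_oppBorel_iff (w : Equiv.Perm (Fin m)) (g : GL (Fin m) A) :
    permGL A w * g * (permGL A w)⁻¹ ∈ oppBorel m A ↔ ∀ a b, w a < w b → g a b = 0 := by
  refine ⟨fun h a b hab => ?_, fun h i j hij => ?_⟩
  · rw [← permGL_conj_apply w]; exact h _ _ hab
  · obtain ⟨a, rfl⟩ := w.surjective i
    obtain ⟨b, rfl⟩ := w.surjective j
    rw [permGL_conj_apply]; exact h _ _ hij

lemma mem_oppUnipW_iff (w : Equiv.Perm (Fin m)) (g : GL (Fin m) A) :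
    g ∈ oppUnipW A w ↔ g ∈ oppUnip m A ∧ ∀ a b, w a < w b → g a b = 0 := by
  rw [← permGL_conj_mem_oppBorel_iff]
  refine and_congr_right fun hg => ⟨fun h => h.1, fun h => ⟨h, fun i => ?_⟩⟩
  obtain ⟨a, rfl⟩ := w.surjective i
  rw [permGL_conj_apply, hg.2]

/-- The diagonal of an invertible lower triangular matrix consists of units, so it can be split off
as the torus factor. Rescaling rows does not affect which entries vanish. -/
lemma mem_torus_mul_oppUnipW_iff (w : Equiv.Perm (Fin m)) (g : GL (Fin m) A) :
    (∃ t ∈ torus m A, ∃ l ∈ oppUnipW A w, g = t * l) ↔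
      g ∈ oppBorel m A ∧ ∀ a b, w a < w b → g a b = 0 := by
  constructor
  · rintro ⟨t, ht, l, hl, rfl⟩
    rw [mem_oppUnipW_iff] at hl
    have key : ∀ i j, l i j = 0 → (t * l) i j = 0 := fun i j h => by
      change (t.val * l.val) i j = 0
      rw [Matrix.mul_apply]
      refine Finset.sum_eq_zero fun x _ => ?_
      by_cases hx : i = x
      · subst hx; exact mul_eq_zero_of_right _ h
      · exact mul_eq_zero_of_left (ht i x hx) _
    exact ⟨fun i j hij => key _ _ (hl.1.1 i j hij), fun a b hab => key _ _ (hl.2 a b hab)⟩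
  · rintro ⟨hg, hw⟩
    choose v hv using isUnit_diag_of_mem_oppBorel hg
    have key : ∀ i j, ((diagGL v)⁻¹ * g) i j = ((v i)⁻¹ : Aˣ) * g i j := fun i j =>
      diagGL_inv_mul_apply v g.val i j
    refine ⟨diagGL v, diagGL_mem_torus v, (diagGL v)⁻¹ * g, ?_, by simp⟩
    rw [mem_oppUnipW_iff]
    refine ⟨⟨fun i j hij => ?_, fun i => ?_⟩, fun a b hab => ?_⟩
    · rw [key, hg i j hij, mul_zero]
    · rw [key, ← hv, Units.inv_mul]
    · rw [key, hw a b hab, mul_zero]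

/-- Row operations with `U⁻ ∩ w⁻¹ U w` clear the entries of a lower triangular matrix outside of
`T U⁻_w`. -/
lemma exists_oppUnip_clear (w : Equiv.Perm (Fin m)) (c : GL (Fin m) A) (hc : c ∈ oppBorel m A) :
    ∃ q : GL (Fin m) A, q ∈ oppUnip m A ∧ permGL A w * q * (permGL A w)⁻¹ ∈ unip m A ∧
      ∀ a b, w a < w b → (q * c) a b = 0 := by
  have row : ∀ a : Fin m, ∃ q : Fin m → A, (∀ b, ¬ (b < a ∧ w a < w b) → q b = 0) ∧
      ∀ b, b < a → w a < w b → ∑ x, q x * c x b = - c a b := by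
    intro a
    let S : Fin m → Prop := fun b => b < a ∧ w a < w b
    -- Row `a` of the clearing matrix solves a linear system in the unknowns indexed by `S`. Its
    -- coefficient matrix is the `S × S` block of `c`, padded by the identity. It is lower
    -- triangular with unit diagonal, so the system is solvable over any ring, independently for
    -- each row.
    let N : Matrix (Fin m) (Fin m) A := Matrix.of fun x y =>
      if S x ∧ S y then c x y else if x = y then 1 else 0
    have hN : N.BlockTriangular OrderDual.toDual := by
      intro i j hij
      have hij' : i < j := hij
      simp only [N, Matrix.of_apply]
      rw [hc i j hij', if_neg hij'.ne]; simp
    have hdet : IsUnit N.det := by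
      rw [det_eq_prod_of_blockTriangular OrderDual.toDual.injective hN, IsUnit.prod_univ_iff]
      intro i
      simp only [N, Matrix.of_apply]
      split_ifs
      · exact isUnit_diag_of_mem_oppBorel hc i
      · exact isUnit_one
    let r : Fin m → A := fun b => if S b then - c a b else 0
    let q := Matrix.vecMul r N⁻¹
    have hq : Matrix.vecMul q N = r := by
      simp only [q]
      rw [Matrix.vecMul_vecMul, Matrix.nonsing_inv_mul _ hdet, Matrix.vecMul_one]
    have h0 : ∀ b, ¬ S b → q b = 0 := by
      intro b hb
      have h := congrFun hq b
      simp only [r, if_neg hb, Matrix.vecMul, dotProduct, N, Matrix.of_apply, hb, and_false,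
        if_false] at h
      simpa using h
    refine ⟨q, h0, fun b hb hw => ?_⟩
    have hb : S b := ⟨hb, hw⟩
    have h := congrFun hq b
    simp only [r, if_pos hb, Matrix.vecMul, dotProduct] at h
    rw [← h]
    refine Finset.sum_congr rfl fun x _ => ?_
    by_cases hx : S x
    · simp [N, hx, hb]
    · rw [h0 x hx, zero_mul, zero_mul]
  choose q hq0 hq using row
  let Q : Matrix (Fin m) (Fin m) A := 1 + Matrix.of q
  have hQ : Q.BlockTriangular OrderDual.toDual := by
    intro i j hij
    have hij' : i < j := hij
    simp only [Q, Matrix.add_apply, Matrix.of_apply]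
    rw [Matrix.one_apply_ne hij'.ne, hq0 _ _ (fun h => hij'.not_gt h.1), add_zero]
  have hdiag : ∀ i, Q i i = 1 := by
    intro i
    simp only [Q, Matrix.add_apply, Matrix.of_apply]
    rw [Matrix.one_apply_eq, hq0 _ _ (fun h => h.1.false), add_zero]
  have hdet : IsUnit Q.det := by
    rw [det_eq_prod_of_blockTriangular OrderDual.toDual.injective hQ]
    simp [hdiag]
  refine ⟨Matrix.GeneralLinearGroup.mk'' Q hdet, ⟨fun i j hij => hQ hij, hdiag⟩,
    ⟨fun i j hij => ?_, fun i => ?_⟩, fun a b hab => ?_⟩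
  · obtain ⟨a, rfl⟩ := w.surjective i
    obtain ⟨b, rfl⟩ := w.surjective j
    rw [permGL_conj_apply]
    change Q a b = 0
    simp only [Q, Matrix.add_apply, Matrix.of_apply]
    rw [Matrix.one_apply_ne (by rintro rfl; exact hij.false),
      hq0 _ _ (fun h => hij.not_gt h.2), add_zero]
  · obtain ⟨a, rfl⟩ := w.surjective i
    rw [permGL_conj_apply]
    exact hdiag a
  · change (Q * c.val) a b = 0
    -- Entries above the diagonal vanish because `Q` and `c` are lower triangular; those below
    -- vanish by the choice of the rows `q`.
    rcases lt_trichotomy a b with h | rfl | h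
    · exact (hQ.mul (N := c.val) (fun i j => hc i j)) h
    · exact absurd hab (lt_irrefl _)
    · have := hq a b h hab
      simp only [Q]
      rw [Matrix.add_mul, Matrix.one_mul, Matrix.add_apply, Matrix.mul_apply]
      change c a b + ∑ x, q a x * c x b = 0
      rw [this, add_neg_cancel]

/-- `B w B⁻ ⊆ U w T U⁻_w`. -/
lemma exists_gauss_decomposition (w : Equiv.Perm (Fin m)) {b c : GL (Fin m) A}
    (hb : b ∈ borel m A) (hc : c ∈ oppBorel m A) :
    ∃ u ∈ unip m A, ∃ t ∈ torus m A, ∃ l ∈ oppUnipW A w,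
      b * permGL A w * c = u * (permGL A w * t * l) := by
  obtain ⟨q, hq, hqw, hqc⟩ := exists_oppUnip_clear w c hc
  set p := permGL A w with hp
  -- Write `b w c = b (w q w⁻¹)⁻¹ · w · (q c)`: the correction absorbed by `b` is upper triangular,
  -- and `q c` is already cleared. It remains to move the diagonal of `b'` to the right of `w`,
  -- where its entries get permuted.
  set b' := b * (p * q * p⁻¹)⁻¹ with hb'
  have hb'B : b' ∈ borel m A := borel_mul hb (borel_inv hqw.1)
  choose v hv using isUnit_diag_of_mem_borel hb'B
  have hu : b' * (diagGL v)⁻¹ ∈ unip m A := by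
    have key : ∀ i j, (b' * (diagGL v)⁻¹) i j = b' i j * ((v j)⁻¹ : Aˣ) := fun i j =>
      mul_diagGL_inv_apply v b'.val i j
    refine ⟨fun i j hij => ?_, fun i => ?_⟩
    · rw [key, hb'B i j hij, zero_mul]
    · rw [key, ← hv, Units.mul_inv]
  have hconj : diagGL v * p = p * diagGL fun i => v (w i) := by
    ext i j
    obtain ⟨a, rfl⟩ := w.surjective i
    change ((diagGL v).val * p.val) (w a) j = (p.val * (diagGL fun i => v (w i)).val) (w a) j
    rw [diagGL_mul_apply, permGL_mul_apply]
    by_cases haj : a = j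
    · subst haj; simp [p, permGL, diagGL]
    · simp [p, permGL, diagGL, haj]
  obtain ⟨t, ht, l, hl, htl⟩ := (mem_torus_mul_oppUnipW_iff w
      ((diagGL fun i => v (w i)) * (q * c))).2 (by
    have key : ∀ i j, ((diagGL fun i => v (w i)) * (q * c)) i j = v (w i) * (q * c) i j :=
      fun i j => diagGL_mul_apply (fun i => v (w i)) (q * c).val i j
    refine ⟨fun i j hij => ?_, fun i j hij => ?_⟩
    · rw [key, oppBorel_mul hq.1 hc i j hij, mul_zero]
    · rw [key, hqc i j hij, mul_zero])
  refine ⟨_, hu, t, ht, l, hl, ?_⟩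
  rw [mul_assoc p t l, ← htl, ← mul_assoc p, ← hconj, hb']
  group

end Triangular

/-! ### Normal forms of matrices and points of the Schubert cells. -/

section NormalForm

variable {A : Type u} [CommRing A] {d n : ℕ}

lemma exists_gl_eq_cols {α : Type*} [LinearOrder α] {b : Fin n → α} (hb : Function.Injective b)
    (I : Fin d ↪o Fin n) {X : Matrix (Fin d) (Fin n) A}
    (h0 : ∀ a l, b l < b (I a) → X a l = 0) (h1 : ∀ a, IsUnit (X a (I a))) :
    ∃ u : GL (Fin d) A, u.val = cols X I := by
  have h : (cols X I).BlockTriangular (b ∘ I) := fun i j hij => h0 _ _ hij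
  refine ⟨Matrix.GeneralLinearGroup.mk'' (cols X I) ?_, rfl⟩
  rw [det_eq_prod_of_blockTriangular (hb.comp I.injective) h, IsUnit.prod_univ_iff]
  exact h1

/-- For `b = id` and `b = toDual` the matrices `Y` below are those of `M_I^-` and `M_I^+`. -/
lemma exists_eq_mul_normalForm_iff {α : Type*} [LinearOrder α] (b : Fin n → α)
    (I : Fin d ↪o Fin n) (X : Matrix (Fin d) (Fin n) A) (u : GL (Fin d) A) :
    (u.val.BlockTriangular (b ∘ I) ∧ ∃ Y : Matrix (Fin d) (Fin n) A,
      (cols Y I = 1 ∧ ∀ a l, b l < b (I a) → Y a l = 0) ∧ X = u.val * Y) ↔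
    u.val = cols X I ∧ ∀ a l, b l < b (I a) → X a l = 0 := by
  have aux : ∀ (v : Matrix (Fin d) (Fin d) A) (Z : Matrix (Fin d) (Fin n) A),
      v.BlockTriangular (b ∘ I) → (∀ a l, b l < b (I a) → Z a l = 0) →
      ∀ a l, b l < b (I a) → (v * Z) a l = 0 := by
    intro v Z hv hZ a l hl
    rw [Matrix.mul_apply]
    refine Finset.sum_eq_zero fun c _ => ?_
    rcases lt_or_ge (b (I c)) (b (I a)) with h | h
    · rw [hv h, zero_mul]
    · rw [hZ c l (hl.trans_le h), mul_zero]
  constructor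
  · rintro ⟨hu, Y, ⟨hY, h0⟩, rfl⟩
    exact ⟨by rw [cols_mul, hY, Matrix.mul_one], aux _ _ hu h0⟩
  · rintro ⟨hu, h0⟩
    have hu' : u.val.BlockTriangular (b ∘ I) := by
      rw [hu]; exact fun i j hij => h0 _ _ hij
    refine ⟨hu', (u⁻¹).val * X, ⟨?_, aux _ _ (blockTriangular_inv hu') h0⟩, ?_⟩
    · rw [cols_mul, ← hu, Units.inv_mul]
    · rw [← Matrix.mul_assoc, Units.mul_inv, Matrix.one_mul]

lemma rowSubmodule_gl_mul {k : Type u} [Field k] [Algebra k A] (g : GL (Fin d) A)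
    (X : Matrix (Fin d) (Fin n) A) : rowSubmodule k (g.val * X) = rowSubmodule k X := by
  have aux : ∀ (C : Matrix (Fin d) (Fin d) A) (X : Matrix (Fin d) (Fin n) A),
      LinearMap.range (C * X).vecMulLinear ≤ LinearMap.range X.vecMulLinear := by
    rintro C X _ ⟨c, rfl⟩
    exact ⟨Matrix.vecMul c C, by simp [Matrix.vecMul_vecMul]⟩
  unfold rowSubmodule
  congr 1
  rw [span_rows_eq_range, span_rows_eq_range]
  refine le_antisymm (aux _ _) ?_
  have := aux (g⁻¹).val (g.val * X)
  rwa [← Matrix.mul_assoc, Units.inv_mul, Matrix.one_mul] at this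

lemma exists_eMat_mul_eq {α : Type*} [LinearOrder α] {b : Fin n → α}
    (hb : Function.Injective b) (I : Fin d ↪o Fin n) {Y : Matrix (Fin d) (Fin n) A}
    (hY : cols Y I = 1) (h0 : ∀ a l, b l < b (I a) → Y a l = 0) :
    ∃ g : GL (Fin n) A, g.val.transpose.BlockTriangular b ∧ eMat A I * g.val.transpose = Y := by
  classical
  -- The rows of `Y` are placed at the positions `I`, and rows of the identity elsewhere. Since `Y_I
  -- = 1`, the result is triangular with ones on the diagonal, hence invertible.
  let N : Matrix (Fin n) (Fin n) A := Matrix.of fun i l =>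
    if h : ∃ a, I a = i then Y h.choose l else if i = l then 1 else 0
  have hI : ∀ a l, N (I a) l = Y a l := fun a l => by
    have h : ∃ a', I a' = I a := ⟨a, rfl⟩
    simp only [N, Matrix.of_apply, dif_pos h]
    rw [I.injective h.choose_spec]
  have hn : ∀ i l, (¬ ∃ a, I a = i) → N i l = if i = l then 1 else 0 := fun i l h => by
    simp only [N, Matrix.of_apply, dif_neg h]
  have hN : N.BlockTriangular b := by
    intro i j hij
    by_cases h : ∃ a, I a = i
    · obtain ⟨a, rfl⟩ := h
      rw [hI, h0 a j hij]
    · rw [hn _ _ h, if_neg]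
      rintro rfl
      exact hij.false
  have hdiag : ∀ i, N i i = 1 := by
    intro i
    by_cases h : ∃ a, I a = i
    · obtain ⟨a, rfl⟩ := h
      rw [hI]
      exact (congrFun (congrFun hY a) a).trans (Matrix.one_apply_eq a)
    · rw [hn _ _ h, if_pos rfl]
  have hdet : IsUnit N.transpose.det := by
    rw [Matrix.det_transpose, det_eq_prod_of_blockTriangular hb hN]
    simp [hdiag]
  refine ⟨Matrix.GeneralLinearGroup.mk'' N.transpose hdet, hN, ?_⟩
  change eMat A I * N = Y
  ext a l
  rw [Matrix.mul_apply, ← hI a l]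
  simp [eMat]

/-- The points of the Bruhat cells, uniformly for `B⁻` (`b = id`) and `B` (`b = toDual`). -/
lemma exists_orbit_iff {k : Type u} [Field k] [Algebra k A] {α : Type*} [LinearOrder α]
    {b : Fin n → α} (hb : Function.Injective b) (I : Fin d ↪o Fin n)
    (X : Matrix (Fin d) (Fin n) A) :
    (∃ g : GL (Fin n) A, g.val.transpose.BlockTriangular b ∧
      rowSubmodule k X = (rowSubmodule k (eMat A I)).map (gAct k g)) ↔
    ∃ (u : GL (Fin d) A) (Y : Matrix (Fin d) (Fin n) A),
      (cols Y I = 1 ∧ ∀ a l, b l < b (I a) → Y a l = 0) ∧ X = u.val * Y := by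
  constructor
  · rintro ⟨g, hg, h⟩
    rw [map_gAct_rowSubmodule] at h
    obtain ⟨c, hc⟩ := exists_eq_mul_of_rowSubmodule_eq _ _ (eMat_mul_fullRank I g) h.symm
    have e : ∀ a l, (eMat A I * g.val.transpose) a l = g.val.transpose (I a) l := fun a l => by
      rw [Matrix.mul_apply]
      simp [eMat]
    have h0 : ∀ a l, b l < b (I a) → (eMat A I * g.val.transpose) a l = 0 := fun a l hl => by
      rw [e]; exact hg hl
    have hdet : g.val.det = ∏ i, g i i := by
      rw [← Matrix.det_transpose]
      exact det_eq_prod_of_blockTriangular hb hg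
    -- The matrix `e_I gᵀ` consists of the rows `I` of `gᵀ`. Its columns `I` form a triangular block
    -- `v` with unit diagonal, and dividing by `v` gives the normal form.
    obtain ⟨v, hv⟩ := exists_gl_eq_cols hb I h0 fun a => by
      rw [e]; exact isUnit_det_of_isUnit_diag hdet _
    obtain ⟨-, Y, hY, hvY⟩ := (exists_eq_mul_normalForm_iff b I _ v).2 ⟨hv, h0⟩
    exact ⟨c * v, Y, hY, by rw [hc, hvY, Units.val_mul, Matrix.mul_assoc]⟩
  · rintro ⟨u, Y, ⟨hY, h0⟩, rfl⟩
    obtain ⟨g, hg, rfl⟩ := exists_eMat_mul_eq hb I hY h0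
    exact ⟨g, hg, by rw [rowSubmodule_gl_mul, map_gAct_rowSubmodule]⟩

end NormalForm

/-! ### The row span map from the hybrid normal form to the stratum. -/

section RowSpan

variable {k : Type u} [Field k] {d n : ℕ} {I J : Fin d ↪o Fin n} {A : CommAlgCat.{u} k}

lemma rowPoint_mem_schubertMinus_iff {X : Matrix (Fin d) (Fin n) A}
    (hX : ∃ Y : Matrix (Fin n) (Fin d) A, X * Y = 1) :
    rowPoint k X hX ∈ (schubertMinus k I).obj A ↔
      ∃ (u : GL (Fin d) A), ∃ Y ∈ mMinus A I, X = u.val * Y := by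
  refine Iff.trans ?_ (exists_orbit_iff (k := k) (b := id) Function.injective_id I X)
  -- Triangularity of the transpose is the defining condition with the two indices quantified in the
  -- opposite order.
  exact exists_congr fun g => and_congr_left fun _ => forall_comm

lemma rowPoint_mem_schubertPlus_iff {X : Matrix (Fin d) (Fin n) A}
    (hX : ∃ Y : Matrix (Fin n) (Fin d) A, X * Y = 1) :
    rowPoint k X hX ∈ (schubertPlus k J).obj A ↔
      ∃ (u : GL (Fin d) A), ∃ Y ∈ mPlus A J, X = u.val * Y := by
  refine Iff.trans ?_ (exists_orbit_iff (k := k) (b := OrderDual.toDual)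
    OrderDual.toDual.injective J X)
  exact exists_congr fun g => and_congr_left fun _ => forall_comm

lemma rowPoint_mem_richardson {w : Equiv.Perm (Fin d)} {X : Matrix (Fin d) (Fin n) A}
    (h : X ∈ (hybrid k I J w).obj A) (hX : ∃ Y : Matrix (Fin n) (Fin d) A, X * Y = 1) :
    rowPoint k X hX ∈ (richardson k I J).obj A := by
  obtain ⟨⟨u, -, Y, hY, h1⟩, ⟨t, -, l, -, Z, hZ, h2⟩⟩ := h
  exact ⟨(rowPoint_mem_schubertMinus_iff hX).2 ⟨u, Y, hY, h1⟩,
    (rowPoint_mem_schubertPlus_iff hX).2 ⟨_, Z, hZ, h2⟩⟩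

/-- From `X = uY` one reads off `X_I = u`, and from `X = w t l Z` one reads off `X_J = w t l`. The
base change matrix is therefore `u⁻¹ · w · (t l)`, with `u⁻¹ ∈ B` and `t l ∈ B⁻`. -/
lemma rowPoint_mem_stratum {w : Equiv.Perm (Fin d)} {X : Matrix (Fin d) (Fin n) A}
    (h : X ∈ (hybrid k I J w).obj A) (hX : ∃ Y : Matrix (Fin n) (Fin d) A, X * Y = 1) :
    (⟨rowPoint k X hX, rowPoint_mem_richardson h hX⟩ : (richardson k I J).toFunctor.obj A) ∈
      (stratum k I J w).obj A := by
  have hR := rowPoint_mem_richardson h hX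
  obtain ⟨⟨u, hu, Y, hY, h1⟩, ⟨t, ht, l, hl, Z, hZ, h2⟩⟩ := h
  have hc : baseChangePt (⟨rowPoint k X hX, hR⟩ : (richardson k I J).toFunctor.obj A) =
      u⁻¹ * (permGL A w * t * l) := by
    refine (baseChangePt_unique _ X hX rfl _).2 ?_
    nth_rw 1 [h1]
    rw [h2, cols_mul, cols_mul, hY.1, hZ.1, Matrix.mul_one, Matrix.mul_one, ← Units.val_mul,
      mul_inv_cancel_left]
  change baseChangePt _ ∈ (bruhatCell k w).obj A
  rw [hc]
  refine ⟨u⁻¹, borel_inv hu.1, t * l, ?_, by simp only [mul_assoc]⟩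
  exact ((mem_torus_mul_oppUnipW_iff w _).1 ⟨t, ht, l, hl, rfl⟩).1

/-- Equal row spans give `X' = gX`. The columns `I` show `g = u' u⁻¹ ∈ U`. The columns `J` show that
`g` is a quotient of two elements of `w T U⁻_w`, which lies in `B⁻` because `w T U⁻_w w⁻¹ ⊆ B⁻`. As
`U ∩ B⁻ = 1`, the two matrices agree. -/
lemma eq_of_rowSubmodule_eq {w : Equiv.Perm (Fin d)} {X X' : Matrix (Fin d) (Fin n) A}
    (h : X ∈ (hybrid k I J w).obj A) (h' : X' ∈ (hybrid k I J w).obj A)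
    (e : rowSubmodule k X = rowSubmodule k X') : X = X' := by
  obtain ⟨g, hg⟩ := exists_eq_mul_of_rowSubmodule_eq X X' (hybrid_le_fullRank k I J w A h) e
  obtain ⟨⟨u, hu, Y, hY, h1⟩, ⟨t, ht, l, hl, Z, hZ, h2⟩⟩ := h
  obtain ⟨⟨u', hu', Y', hY', h1'⟩, ⟨t', ht', l', hl', Z', hZ', h2'⟩⟩ := h'
  have e1 : u' = g * u := by
    have := congrArg (fun M => cols M I) hg
    simp only [cols_mul, h1, h1', hY.1, hY'.1, Matrix.mul_one] at this
    exact Units.ext this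
  have e2 : permGL A w * t' * l' = g * (permGL A w * t * l) := by
    have := congrArg (fun M => cols M J) hg
    simp only [cols_mul, h2, h2', hZ.1, hZ'.1, Matrix.mul_one] at this
    exact Units.ext this
  have g1 : g ∈ unip d A := by
    rw [eq_mul_inv_of_mul_eq e1.symm]
    exact unip_mul hu' (unip_inv hu)
  have g2 : g ∈ oppBorel d A := by
    have aux : ∀ t ∈ torus d A, ∀ l ∈ oppUnipW A w,
        permGL A w * (t * l) * (permGL A w)⁻¹ ∈ oppBorel d A := fun t ht l hl =>
      (permGL_conj_mem_oppBorel_iff w _).2 ((mem_torus_mul_oppUnipW_iff w _).1 ⟨t, ht, l, hl, rfl⟩).2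
    have : g = (permGL A w * (t' * l') * (permGL A w)⁻¹) *
        (permGL A w * (t * l) * (permGL A w)⁻¹)⁻¹ := by
      rw [eq_mul_inv_of_mul_eq e2.symm]
      group
    rw [this]
    exact oppBorel_mul (aux _ ht' _ hl') (oppBorel_inv (aux _ ht _ hl))
  have hg1 : g.val = 1 := by
    ext i j
    rcases lt_trichotomy i j with hij | rfl | hij
    · rw [Matrix.one_apply_ne hij.ne]; exact g2 i j hij
    · rw [Matrix.one_apply_eq]; exact g1.2 i
    · rw [Matrix.one_apply_ne hij.ne']; exact g1.1 i j hij
  rw [hg, hg1, Matrix.one_mul]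

lemma exists_hybrid_of_mem_stratum {w : Equiv.Perm (Fin d)}
    (W : (richardson k I J).toFunctor.obj A) (hW : W ∈ (stratum k I J w).obj A) :
    ∃ X ∈ (hybrid k I J w).obj A, rowSubmodule k X = W.1.toSubmodule := by
  obtain ⟨X, hX, hXW⟩ := exists_rowPoint_eq W.2
  have hWR := W.2
  rw [← hXW] at hWR
  obtain ⟨u, Y, hY, h1⟩ := (rowPoint_mem_schubertMinus_iff hX).1 hWR.1
  obtain ⟨v, Z, hZ, h2⟩ := (rowPoint_mem_schubertPlus_iff hX).1 hWR.2
  obtain ⟨b, hb, c, hc, hbc⟩ := hW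
  obtain ⟨u₀, hu₀, t, ht, l, hl, hdec⟩ := exists_gauss_decomposition w hb hc
  rw [hdec] at hbc
  have h3 := (baseChangePt_unique W X hX hXW _).1 hbc
  nth_rw 1 [h1] at h3
  rw [h2, cols_mul, cols_mul, hY.1, hZ.1, Matrix.mul_one, Matrix.mul_one, ← Units.val_mul] at h3
  have h4 : u * (u₀ * (permGL A w * t * l)) = v := Units.ext h3
  -- Here `X_I = u` and `X_J = v = u u₀ w t l`, so this rescaling makes the columns `I` equal to
  -- `u₀⁻¹ ∈ U` and the columns `J` equal to `w t l`.
  refine ⟨((u * u₀)⁻¹).val * X, ⟨⟨u₀⁻¹, unip_inv hu₀, Y, hY, ?_⟩, t, ht, l, hl, Z, hZ, ?_⟩, ?_⟩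
  · rw [h1, ← Matrix.mul_assoc, ← Units.val_mul]
    congr 2
    group
  · rw [h2, ← Matrix.mul_assoc, ← Units.val_mul, ← h4]
    congr 2
    group
  · rw [rowSubmodule_gl_mul, ← hXW]
    rfl

variable (k I J)

/-- The row span map from the hybrid normal form to the stratum. -/
noncomputable def hybridToStratum (w : Equiv.Perm (Fin d)) :
    (hybrid k I J w).toFunctor ⟶ (stratum k I J w).toFunctor :=
  Subfunctor.lift (Subfunctor.lift
    (Subfunctor.homOfLe (hybrid_le_fullRank k I J w) ≫ rowSpan k d n) (by
      rintro A _ ⟨X, rfl⟩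
      exact rowPoint_mem_richardson X.2 (hybrid_le_fullRank k I J w A X.2))) (by
    rintro A _ ⟨X, rfl⟩
    exact rowPoint_mem_stratum X.2 (hybrid_le_fullRank k I J w A X.2))

instance (w : Equiv.Perm (Fin d)) : IsIso (hybridToStratum k I J w) := by
  have : ∀ A, IsIso ((hybridToStratum k I J w).app A) := fun A => by
    rw [isIso_iff_bijective]
    constructor
    · intro X X' h
      exact Subtype.ext (eq_of_rowSubmodule_eq X.2 X'.2
        (congrArg (fun W => W.1.1.toSubmodule) h))
    · intro W
      obtain ⟨X, hX, h⟩ := exists_hybrid_of_mem_stratum W.1 W.2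
      exact ⟨⟨X, hX⟩, Subtype.ext (Subtype.ext (Module.Grassmannian.ext h))⟩
  exact NatIso.isIso_of_isIso_app _

end RowSpan

/-! ### Lengths of subsets and the number of free coordinates. -/

section Length

lemma card_filter_lt_and_notMem_range {d n : ℕ} (I : Fin d ↪o Fin n) (a : Fin d) :
    (Finset.univ.filter fun y => y < I a ∧ y ∉ Set.range I).card + (a : ℕ) = I a := by
  classical
  have h1 : (Finset.univ.filter fun y => y < I a ∧ y ∈ Set.range I) =
      (Finset.Iio a).map I.toEmbedding := by
    ext y
    simp only [Finset.mem_filter, Finset.mem_univ, true_and, Set.mem_range, Finset.mem_map,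
      Finset.mem_Iio]
    constructor
    · rintro ⟨hy, b, rfl⟩
      exact ⟨b, I.lt_iff_lt.1 hy, rfl⟩
    · rintro ⟨b, hb, rfl⟩
      exact ⟨I.lt_iff_lt.2 hb, b, rfl⟩
  have h2 := Finset.card_filter_add_card_filter_not (s := Finset.Iio (I a))
    (fun y => y ∈ Set.range I)
  have h3 : ∀ p : Fin n → Prop, ∀ [DecidablePred p],
      (Finset.Iio (I a)).filter p = Finset.univ.filter fun y => y < I a ∧ p y := by
    intro p _
    ext y
    simp
  rw [h3, h3, h1, Finset.card_map, Fin.card_Iio, Fin.card_Iio] at h2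
  rw [add_comm]
  convert h2

/-- For any admissible `v`, a pair `y < x` with `x ∈ I`, `y ∉ I` pulls back to an inversion, since
`v⁻¹ x` is among the first `d` positions and `v⁻¹ y` is not. The permutation increasing on the first
`d` positions and on the remaining ones has no further inversions, so the bound is attained. -/
lemma subsetLength_eq_card {d n : ℕ} (I : Fin d ↪o Fin n) :
    subsetLength I = (Finset.univ.filter fun p : Fin n × Fin n =>
      p.1 ∈ Set.range I ∧ p.2 ∉ Set.range I ∧ p.2 < p.1).card := by
  classical
  have hmem : ∀ v : Equiv.Perm (Fin n), v '' {l | l.val < d} = Set.range I →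
      ∀ l, v l ∈ Set.range I ↔ l.val < d := fun v hv l => by
    rw [← hv]; exact v.injective.mem_set_image
  refine IsLeast.csInf_eq ⟨?_, ?_⟩
  · obtain ⟨e, rfl⟩ := Nat.exists_eq_add_of_le (by
      simpa using Fintype.card_le_of_injective I I.injective : d ≤ n)
    let s : Finset (Fin (d + e)) := Finset.univ.map I.toEmbedding
    have hs : s.card = d := by simp [s]
    have hsc : sᶜ.card = e := by rw [Finset.card_compl, hs]; simp
    -- The minimal coset representative: the elements of `I` in increasing order, followed by those
    -- of the complement in increasing order.
    let v : Equiv.Perm (Fin (d + e)) := finSumFinEquiv.symm.trans (finSumEquivOfFinset hs hsc)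
    have v1 : ∀ a : Fin d, v (Fin.castAdd e a) = s.orderEmbOfFin hs a := fun a => by
      simp [v]
    have v2 : ∀ a : Fin e, v (Fin.natAdd d a) = sᶜ.orderEmbOfFin hsc a := fun a => by
      simp [v]
    have hv : v '' {l | l.val < d} = Set.range I := by
      have h1 : {l : Fin (d + e) | l.val < d} = Set.range (Fin.castAdd e) := by
        ext l
        exact ⟨fun h => ⟨⟨l, h⟩, rfl⟩, by rintro ⟨a, rfl⟩; exact a.2⟩
      rw [h1, ← Set.range_comp]
      have h2 : v ∘ Fin.castAdd e = s.orderEmbOfFin hs := funext v1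
      rw [h2, Finset.range_orderEmbOfFin]
      simp [s]
    refine ⟨v, hv, ?_⟩
    refine Finset.card_bij (fun p _ => (v p.1, v p.2)) ?_ ?_ ?_
    · rintro ⟨p, q⟩ h
      simp only [Finset.mem_filter, Finset.mem_univ, true_and] at h ⊢
      rw [hmem v hv, hmem v hv]
      obtain ⟨hpq, hvq⟩ := h
      refine ⟨?_, ?_, hvq⟩
      · by_contra hp
        obtain ⟨a, rfl⟩ : ∃ a, p = Fin.natAdd d a := ⟨⟨p - d, by omega⟩, Fin.ext (by simp; omega)⟩
        obtain ⟨b, rfl⟩ : ∃ b, q = Fin.natAdd d b :=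
          ⟨⟨q - d, by omega⟩, Fin.ext (by simp; omega)⟩
        rw [v2, v2] at hvq
        have := (OrderEmbedding.lt_iff_lt _).1 hvq
        simp at hpq
        exact this.not_gt hpq
      · intro hq
        obtain ⟨a, rfl⟩ : ∃ a, p = Fin.castAdd e a := ⟨⟨p, by omega⟩, rfl⟩
        obtain ⟨b, rfl⟩ : ∃ b, q = Fin.castAdd e b := ⟨⟨q, hq⟩, rfl⟩
        rw [v1, v1] at hvq
        have := (OrderEmbedding.lt_iff_lt _).1 hvq
        exact this.not_gt hpq
    · rintro ⟨p, q⟩ _ ⟨p', q'⟩ _ h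
      simpa using h
    · rintro ⟨x, y⟩ h
      obtain ⟨p, rfl⟩ := v.surjective x
      obtain ⟨q, rfl⟩ := v.surjective y
      simp only [Finset.mem_filter, Finset.mem_univ, true_and] at h
      rw [hmem v hv, hmem v hv] at h
      refine ⟨(p, q), ?_, rfl⟩
      simp only [Finset.mem_filter, Finset.mem_univ, true_and]
      exact ⟨Fin.lt_def.2 (by omega), h.2.2⟩
  · rintro _ ⟨v, hv, rfl⟩
    -- The lower bound: pulling back along `v` injects the pairs into the inversions of `v`.
    refine Finset.card_le_card_of_injOn (fun p => (v.symm p.1, v.symm p.2)) ?_ ?_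
    · rintro ⟨x, y⟩ h
      obtain ⟨p, rfl⟩ := v.surjective x
      obtain ⟨q, rfl⟩ := v.surjective y
      simp only [Finset.coe_filter, Finset.mem_univ, true_and, Set.mem_ofPred_eq] at h
      rw [hmem v hv, hmem v hv] at h
      simp only [Finset.coe_filter, Finset.mem_univ, true_and, Set.mem_ofPred_eq,
        Equiv.symm_apply_apply]
      exact ⟨Fin.lt_def.2 (by omega), h.2.2⟩
    · rintro ⟨p, q⟩ _ ⟨p', q'⟩ _ h
      simpa using h

/-- Group the pairs by their member `I a`: of the `I a` smaller indices (counted from `0`), exactly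
`a` lie in `I`. Integers are used to avoid truncated subtraction. -/
lemma subsetLength_eq_sum {d n : ℕ} (I : Fin d ↪o Fin n) :
    (subsetLength I : ℤ) = ∑ a, (((I a : ℕ) : ℤ) - (a : ℕ)) := by
  classical
  have h : (Finset.univ.filter fun p : Fin n × Fin n =>
      p.1 ∈ Set.range I ∧ p.2 ∉ Set.range I ∧ p.2 < p.1).card =
      ∑ a, (Finset.univ.filter fun y => y < I a ∧ y ∉ Set.range I).card := by
    rw [← Finset.card_sigma]
    symm
    refine Finset.card_bij (fun p _ => (I p.1, p.2)) ?_ ?_ ?_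
    · rintro ⟨a, y⟩ h
      simp only [Finset.mem_sigma, Finset.mem_univ, true_and, Finset.mem_filter] at h ⊢
      exact ⟨⟨a, rfl⟩, h.2, h.1⟩
    · rintro ⟨a, y⟩ _ ⟨a', y'⟩ _ h
      simp only [Prod.mk.injEq, EmbeddingLike.apply_eq_iff_eq] at h
      obtain ⟨rfl, rfl⟩ := h
      rfl
    · rintro ⟨x, y⟩ h
      simp only [Finset.mem_filter, Finset.mem_univ, true_and] at h
      obtain ⟨⟨a, rfl⟩, h2, h3⟩ := h
      exact ⟨⟨a, y⟩, by simpa using ⟨h3, fun b hb => h2 ⟨b, hb⟩⟩, rfl⟩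
  rw [subsetLength_eq_card]
  trans ((∑ a, (Finset.univ.filter fun y => y < I a ∧ y ∉ Set.range I).card : ℕ) : ℤ)
  · rw [← h]
  push_cast
  refine Finset.sum_congr rfl fun a _ => ?_
  have := card_filter_lt_and_notMem_range I a
  have e : ((I a : ℕ) : ℤ) = (Finset.univ.filter fun y => y < I a ∧ y ∉ Set.range I).card + (a : ℕ) := by
    exact_mod_cast this.symm
  rw [e, add_sub_cancel_right]

/-- The positions of the free coordinates of the hybrid normal form: `(a, l)` stands for the entry
in row `w a` and column `l`. -/
def freePositions {d n : ℕ} (I J : Fin d ↪o Fin n) (w : Equiv.Perm (Fin d)) :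
    Finset (Fin d × Fin n) :=
  Finset.univ.filter fun p =>
    I (w p.1) < p.2 ∧ p.2 < J p.1 ∧ ∀ b, b < p.1 → w p.1 < w b → p.2 ≠ J b

/-- The interval `(I (w a), J a]` splits into the free columns, the endpoint `J a` when the interval
is non-empty, and the columns `J b` cleared by inversions. The latter do lie in the interval: `I (w
a) < I (w b) ≤ J b < J a`, where the middle inequality is the hypothesis at `b`. -/
lemma card_row_eq {d n : ℕ} {I J : Fin d ↪o Fin n} {w : Equiv.Perm (Fin d)}
    (h : ∀ a, I (w a) ≤ J a) (a : Fin d) :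
    (Finset.univ.filter fun l =>
        I (w a) < l ∧ l < J a ∧ ∀ b, b < a → w a < w b → l ≠ J b).card +
      (if I (w a) ≠ J a then 1 else 0) +
      (Finset.univ.filter fun b => b < a ∧ w a < w b).card + (I (w a) : ℕ) = J a := by
  classical
  have hJ : ∀ b, b < a → w a < w b → I (w a) < J b ∧ J b < J a := fun b hb hw =>
    ⟨(I.lt_iff_lt.2 hw).trans_le (h b), J.lt_iff_lt.2 hb⟩
  have e : Finset.Ioc (I (w a)) (J a) =
      ((Finset.univ.filter fun l =>
        I (w a) < l ∧ l < J a ∧ ∀ b, b < a → w a < w b → l ≠ J b) ∪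
      (if I (w a) ≠ J a then {J a} else ∅)) ∪
      (Finset.univ.filter fun b => b < a ∧ w a < w b).map J.toEmbedding := by
    ext l
    simp only [Finset.mem_Ioc, Finset.mem_union, Finset.mem_filter, Finset.mem_univ, true_and,
      Finset.mem_map, RelEmbedding.coe_toEmbedding]
    constructor
    · rintro ⟨h1, h2⟩
      rcases h2.lt_or_eq with h2 | rfl
      · by_cases hb : ∀ b, b < a → w a < w b → l ≠ J b
        · exact Or.inl (Or.inl ⟨h1, h2, hb⟩)
        · push Not at hb
          obtain ⟨b, hb, hw, rfl⟩ := hb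
          exact Or.inr ⟨b, ⟨hb, hw⟩, rfl⟩
      · refine Or.inl (Or.inr ?_)
        rw [if_pos h1.ne]; simp
    · rintro ((⟨h1, h2, -⟩ | h1) | ⟨b, ⟨hb, hw⟩, rfl⟩)
      · exact ⟨h1, h2.le⟩
      · split_ifs at h1 with h2
        · rw [Finset.mem_singleton] at h1
          subst h1
          exact ⟨lt_of_le_of_ne (h a) h2, le_rfl⟩
        · simp at h1
      · exact ⟨(hJ b hb hw).1, (hJ b hb hw).2.le⟩
  have hc := congrArg Finset.card e
  rw [Finset.card_union_of_disjoint, Finset.card_union_of_disjoint, Finset.card_map,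
    Fin.card_Ioc] at hc
  · have := Fin.le_def.1 (h a)
    have h3 : (if I (w a) ≠ J a then {J a} else ∅ : Finset (Fin n)).card =
        if I (w a) ≠ J a then 1 else 0 := by split_ifs <;> simp
    rw [h3] at hc
    omega
  · rw [Finset.disjoint_left]
    intro l hl hl'
    split_ifs at hl' with h2
    · rw [Finset.mem_singleton] at hl'
      subst hl'
      simp at hl
    · simp at hl'
  · rw [Finset.disjoint_left]
    intro l hl hl'
    simp only [Finset.mem_map, Finset.mem_filter, Finset.mem_univ, true_and,
      RelEmbedding.coe_toEmbedding] at hl'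
    obtain ⟨b, ⟨hb, hw⟩, rfl⟩ := hl'
    rw [Finset.mem_union] at hl
    rcases hl with hl | hl
    · simp only [Finset.mem_filter, Finset.mem_univ, true_and] at hl
      exact hl.2.2 b hb hw rfl
    · split_ifs at hl with h2
      · rw [Finset.mem_singleton] at hl
        exact hb.ne (J.injective hl)
      · simp at hl

lemma card_freePositions {d n : ℕ} {I J : Fin d ↪o Fin n} {w : Equiv.Perm (Fin d)}
    (h : ∀ a, I (w a) ≤ J a) :
    ((freePositions I J w).card : ℤ) = subsetLength J - subsetLength I -
      (Finset.univ.filter fun a => I (w a) ≠ J a).card - permLength w := by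
  classical
  have h1 : (freePositions I J w).card = ∑ a, (Finset.univ.filter fun l =>
        I (w a) < l ∧ l < J a ∧ ∀ b, b < a → w a < w b → l ≠ J b).card := by
    rw [freePositions, Finset.card_filter, Fintype.sum_prod_type]
    exact Finset.sum_congr rfl fun a _ => (Finset.card_filter _ _).symm
  have h2 : permLength w = ∑ a, (Finset.univ.filter fun b => b < a ∧ w a < w b).card := by
    rw [permLength, Finset.card_filter, Fintype.sum_prod_type_right]
    exact Finset.sum_congr rfl fun a _ => (Finset.card_filter _ _).symm
  -- When the row identities are summed, `∑ I (w a) = ∑ I a`, and the terms `∑ a` in the two subset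
  -- lengths cancel.
  have h3 := Finset.sum_congr rfl fun a (_ : a ∈ Finset.univ) => card_row_eq h a
  rw [Finset.sum_add_distrib, Finset.sum_add_distrib, Finset.sum_add_distrib, ← h1, ← h2,
    ← Finset.card_filter, Equiv.sum_comp w (fun a => (I a : ℕ))] at h3
  rw [subsetLength_eq_sum, subsetLength_eq_sum, Finset.sum_sub_distrib, Finset.sum_sub_distrib,
    ← Nat.cast_sum, ← Nat.cast_sum, ← h3]
  push_cast
  ring

end Length

/-! ### Entrywise description and parametrization of the hybrid normal form. -/

section Coordinates

/-- The factor `u` can only be `X_I`, so the condition says that `X_I` is unipotent; its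
triangularity already follows from the zeros to the left of the columns `I a`. -/
lemma exists_unip_mul_iff {A : Type u} [CommRing A] {d n : ℕ} (I : Fin d ↪o Fin n)
    (X : Matrix (Fin d) (Fin n) A) :
    (∃ u ∈ unip d A, ∃ Y ∈ mMinus A I, X = u.val * Y) ↔
      (∀ a l, l < I a → X a l = 0) ∧ ∀ a, X a (I a) = 1 := by
  constructor
  · rintro ⟨u, hu, Y, hY, h⟩
    obtain ⟨h1, h2⟩ := (exists_eq_mul_normalForm_iff id I X u).1
      ⟨fun i j hij => hu.1 i j (I.lt_iff_lt.1 hij), Y, hY, h⟩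
    exact ⟨h2, fun a => (congrFun (congrFun h1 a) a).symm.trans (hu.2 a)⟩
  · rintro ⟨h0, h1⟩
    obtain ⟨u, hu⟩ := exists_gl_eq_cols (b := id) Function.injective_id I h0 fun a => by
      rw [h1]; exact isUnit_one
    obtain ⟨h2, Y, hY, h⟩ := (exists_eq_mul_normalForm_iff id I X u).2 ⟨hu, h0⟩
    refine ⟨u, ⟨fun i j hij => h2 (I.lt_iff_lt.2 hij), fun a => ?_⟩, Y, hY, h⟩
    exact (congrFun (congrFun hu a) a).trans (h1 a)

lemma exists_perm_torus_oppUnipW_mul_iff {A : Type u} [CommRing A] {d n : ℕ} (J : Fin d ↪o Fin n)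
    (w : Equiv.Perm (Fin d)) (X : Matrix (Fin d) (Fin n) A) :
    (∃ t ∈ torus d A, ∃ l ∈ oppUnipW A w, ∃ Y ∈ mPlus A J, X = (permGL A w * t * l).val * Y) ↔
      (∀ a l, J a < l → X (w a) l = 0) ∧ (∀ a, IsUnit (X (w a) (J a))) ∧
        ∀ a b, b < a → w a < w b → X (w a) (J b) = 0 := by
  constructor
  · rintro ⟨t, ht, l, hl, Y, hY, h⟩
    obtain ⟨hB, hw⟩ := (mem_torus_mul_oppUnipW_iff w _).1 ⟨t, ht, l, hl, rfl⟩
    obtain ⟨h1, h2⟩ := (exists_eq_mul_normalForm_iff OrderDual.toDual J ((t * l).val * Y) (t * l)).1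
      ⟨fun i j hij => hB i j (J.lt_iff_lt.1 hij), Y, hY, rfl⟩
    have e : ∀ a c, X (w a) c = ((t * l).val * Y) a c := fun a c => by
      rw [h, mul_assoc, Units.val_mul, Matrix.mul_assoc, permGL_mul_apply]
    have e' : ∀ a b, X (w a) (J b) = (t * l) a b := fun a b => by
      rw [e]; exact (congrFun (congrFun h1 a) b).symm
    refine ⟨fun a c hc => ?_, fun a => ?_, fun a b _ hab => ?_⟩
    · rw [e]; exact h2 a c hc
    · rw [e']; exact isUnit_diag_of_mem_oppBorel hB a
    · rw [e']; exact hw a b hab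
  · rintro ⟨h0, h1, h2⟩
    -- Permuting the rows removes the factor `w`: the matrix `Z_J` then has to lie in `T U⁻_w`.
    let Z : Matrix (Fin d) (Fin n) A := X.submatrix w id
    obtain ⟨g, hg⟩ := exists_gl_eq_cols (b := OrderDual.toDual) OrderDual.toDual.injective J
      (X := Z) (fun a l hl => h0 a l hl) h1
    obtain ⟨h3, Y, hY, h⟩ := (exists_eq_mul_normalForm_iff OrderDual.toDual J Z g).2
      ⟨hg, fun a l hl => h0 a l hl⟩
    have hB : g ∈ oppBorel d A := fun i j hij => h3 (J.lt_iff_lt.2 hij)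
    obtain ⟨t, ht, l, hl, rfl⟩ := (mem_torus_mul_oppUnipW_iff w g).2 ⟨hB, fun a b hab => by
      -- Only the positions with `b < a` need the extra vanishing condition; for `a < b` the entry
      -- is zero because `g` is lower triangular.
      rcases lt_trichotomy a b with h | rfl | h
      · exact hB a b h
      · exact absurd hab (lt_irrefl _)
      · exact (congrFun (congrFun hg a) b).trans (h2 a b h hab)⟩
    refine ⟨t, ht, l, hl, Y, hY, ?_⟩
    rw [mul_assoc, Units.val_mul, Matrix.mul_assoc, ← h]
    ext i j
    obtain ⟨a, rfl⟩ := w.surjective i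
    rw [permGL_mul_apply]
    rfl

/-- The hybrid normal form in terms of matrix entries. -/
lemma mem_hybrid_iff {k : Type u} [Field k] {d n : ℕ} {I J : Fin d ↪o Fin n}
    {w : Equiv.Perm (Fin d)} {A : CommAlgCat.{u} k} (X : Matrix (Fin d) (Fin n) A) :
    X ∈ (hybrid k I J w).obj A ↔
      ((∀ a l, l < I (w a) → X (w a) l = 0) ∧ ∀ a, X (w a) (I (w a)) = 1) ∧
      (∀ a l, J a < l → X (w a) l = 0) ∧ (∀ a, IsUnit (X (w a) (J a))) ∧
        ∀ a b, b < a → w a < w b → X (w a) (J b) = 0 := by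
  refine (and_congr (exists_unip_mul_iff I X) (exists_perm_torus_oppUnipW_mul_iff J w X)).trans ?_
  -- The conditions coming from `I` are reindexed along `w`, so that both groups of conditions speak
  -- about row `w a`.
  rw [w.forall_congr_right (q := fun a => ∀ l, l < I a → X a l = 0),
    w.forall_congr_right (q := fun a => X a (I a) = 1)]

/-- Otherwise the entry `1` in column `I (w a)` would lie to the right of column `J a`, where the
row vanishes. -/
lemma le_of_mem_hybrid {k : Type u} [Field k] {d n : ℕ} {I J : Fin d ↪o Fin n}
    {w : Equiv.Perm (Fin d)} {A : CommAlgCat.{u} k} [Nontrivial A] {X : Matrix (Fin d) (Fin n) A}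
    (hX : X ∈ (hybrid k I J w).obj A) (a : Fin d) : I (w a) ≤ J a := by
  obtain ⟨⟨-, h1⟩, h2, -⟩ := (mem_hybrid_iff X).1 hX
  by_contra! h
  exact one_ne_zero ((h1 a).symm.trans (h2 a _ h))

variable {d n : ℕ} (I J : Fin d ↪o Fin n) (w : Equiv.Perm (Fin d))

/-- The matrix in hybrid normal form with given unit and free coordinates. -/
def hybridMatrix {A : Type u} [CommRing A]
    (s : {a // a ∈ Finset.univ.filter fun a => I (w a) ≠ J a} → Aˣ)
    (x : {p // p ∈ freePositions I J w} → A) : Matrix (Fin d) (Fin n) A :=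
  Matrix.of fun i l =>
    if l = I i then 1
    else if h : l = J (w.symm i) ∧ w.symm i ∈ Finset.univ.filter fun a => I (w a) ≠ J a then
      (s ⟨w.symm i, h.2⟩ : A)
    else if h : (w.symm i, l) ∈ freePositions I J w then x ⟨(w.symm i, l), h⟩
    else 0

section

variable {I J w} {A : Type u} [CommRing A]
  (s : {a // a ∈ Finset.univ.filter fun a => I (w a) ≠ J a} → Aˣ)
  (x : {p // p ∈ freePositions I J w} → A)

lemma hybridMatrix_apply (a : Fin d) (l : Fin n) : hybridMatrix I J w s x (w a) l =
    if l = I (w a) then 1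
    else if h : l = J a ∧ a ∈ Finset.univ.filter fun a => I (w a) ≠ J a then (s ⟨a, h.2⟩ : A)
    else if h : (a, l) ∈ freePositions I J w then x ⟨(a, l), h⟩
    else 0 := by
  simp only [hybridMatrix, Matrix.of_apply, Equiv.symm_apply_apply]

lemma hybridMatrix_one (a : Fin d) : hybridMatrix I J w s x (w a) (I (w a)) = 1 := by
  rw [hybridMatrix_apply, if_pos rfl]

lemma hybridMatrix_unit (a : {a // a ∈ Finset.univ.filter fun a => I (w a) ≠ J a}) :
    hybridMatrix I J w s x (w a) (J a) = s a := by
  have h := a.2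
  simp only [Finset.mem_filter, Finset.mem_univ, true_and] at h
  rw [hybridMatrix_apply, if_neg h.symm, dif_pos ⟨rfl, a.2⟩]

lemma hybridMatrix_free (p : {p // p ∈ freePositions I J w}) :
    hybridMatrix I J w s x (w p.1.1) p.1.2 = x p := by
  have h := p.2
  simp only [freePositions, Finset.mem_filter, Finset.mem_univ, true_and] at h
  rw [hybridMatrix_apply, if_neg h.1.ne', dif_neg (fun h' => h.2.1.ne h'.1), dif_pos p.2]

lemma hybridMatrix_zero {a : Fin d} {l : Fin n} (h1 : l ≠ I (w a)) (h2 : l ≠ J a)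
    (h3 : (a, l) ∉ freePositions I J w) : hybridMatrix I J w s x (w a) l = 0 := by
  rw [hybridMatrix_apply, if_neg h1, dif_neg (fun h => h2 h.1), dif_neg h3]

/-- Recognizes a matrix by its entries at the four kinds of positions. Both naturality and
surjectivity of the parametrization reduce to this. -/
lemma eq_hybridMatrix {X : Matrix (Fin d) (Fin n) A} (h1 : ∀ a, X (w a) (I (w a)) = 1)
    (h2 : ∀ a : {a // a ∈ Finset.univ.filter fun a => I (w a) ≠ J a}, X (w a.1) (J a.1) = s a)
    (h3 : ∀ p : {p // p ∈ freePositions I J w}, X (w p.1.1) p.1.2 = x p)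
    (h4 : ∀ a l, l ≠ I (w a) → l ≠ J a → (a, l) ∉ freePositions I J w → X (w a) l = 0) :
    X = hybridMatrix I J w s x := by
  ext i l
  obtain ⟨a, rfl⟩ := w.surjective i
  by_cases e1 : l = I (w a)
  · subst e1
    rw [h1, hybridMatrix_one]
  by_cases e2 : l = J a
  · subst e2
    have ha : a ∈ Finset.univ.filter fun a => I (w a) ≠ J a := by
      simpa using fun h => e1 h.symm
    rw [hybridMatrix_unit s x ⟨a, ha⟩, ← h2]
  by_cases e3 : (a, l) ∈ freePositions I J w
  · rw [hybridMatrix_free s x ⟨(a, l), e3⟩, ← h3]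
  · rw [hybridMatrix_zero s x e1 e2 e3, h4 a l e1 e2 e3]

end

variable {k : Type u} [Field k] {I J w}

/-- The inequalities ensure that the prescribed values do not collide: forced zeros left of `I (w
a)` or right of `J a` avoid both special columns, and a cleared column `J b` lies strictly between
them. If `I (w a) = J a`, the required unit is the entry `1` itself. -/
lemma hybridMatrix_mem (h : ∀ a, I (w a) ≤ J a) (A : CommAlgCat.{u} k)
    (s : {a // a ∈ Finset.univ.filter fun a => I (w a) ≠ J a} → (A : Type u)ˣ)
    (x : {p // p ∈ freePositions I J w} → A) :
    hybridMatrix I J w s x ∈ (hybrid k I J w).obj A := by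
  refine (mem_hybrid_iff _).2 ⟨⟨fun a l hl => ?_, fun a => hybridMatrix_one s x a⟩,
    fun a l hl => ?_, fun a => ?_, fun a b hb hw => ?_⟩
  · refine hybridMatrix_zero s x hl.ne (hl.trans_le (h a)).ne fun hp => ?_
    simp only [freePositions, Finset.mem_filter] at hp
    exact hl.not_gt hp.2.1
  · refine hybridMatrix_zero s x ((h a).trans_lt hl).ne' hl.ne' fun hp => ?_
    simp only [freePositions, Finset.mem_filter] at hp
    exact hl.not_gt hp.2.2.1
  · by_cases ha : I (w a) = J a
    · rw [← ha, hybridMatrix_one]; exact isUnit_one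
    · rw [hybridMatrix_unit s x ⟨a, by simpa using ha⟩]; exact Units.isUnit _
  · refine hybridMatrix_zero s x ((I.lt_iff_lt.2 hw).trans_le (h b)).ne' (J.lt_iff_lt.2 hb).ne
      fun hp => ?_
    simp only [freePositions, Finset.mem_filter] at hp
    exact hp.2.2.2 b hb hw rfl

/-- The parametrization of the hybrid normal form by its coordinates. -/
noncomputable def gmAffineToHybrid (h : ∀ a, I (w a) ≤ J a) :
    gmAffine k (Finset.univ.filter fun a => I (w a) ≠ J a).card (freePositions I J w).card ⟶
      (hybrid k I J w).toFunctor where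
  app A := ↾fun p => ⟨hybridMatrix I J w (fun a => p.1 (Finset.equivFin _ a))
    (fun a => p.2 (Finset.equivFin _ a)), hybridMatrix_mem h A _ _⟩
  naturality A B f := by
    refine ConcreteCategory.hom_ext _ _ fun p => ?_
    refine Subtype.ext (Eq.symm (eq_hybridMatrix (A := B)
      (s := fun a => Units.map (f.hom : (A : Type u) →* B) (p.1 (Finset.equivFin _ a)))
      (x := fun a => f.hom (p.2 (Finset.equivFin _ a)))
      (X := (hybridMatrix I J w (fun a => p.1 (Finset.equivFin _ a))
        (fun a => p.2 (Finset.equivFin _ a))).map f.hom)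
      (fun a => ?_) (fun a => ?_) (fun a => ?_) (fun a l h1 h2 h3 => ?_)))
    · exact (congrArg f.hom (hybridMatrix_one _ _ a)).trans (map_one f.hom)
    · exact congrArg f.hom (hybridMatrix_unit _ _ a)
    · exact congrArg f.hom (hybridMatrix_free _ _ a)
    · exact (congrArg f.hom (hybridMatrix_zero _ _ h1 h2 h3)).trans (map_zero f.hom)

instance (h : ∀ a, I (w a) ≤ J a) : IsIso (gmAffineToHybrid (k := k) h) := by
  have : ∀ A, IsIso ((gmAffineToHybrid (k := k) h).app A) := fun A => by
    rw [isIso_iff_bijective]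
    constructor
    · rintro ⟨s, x⟩ ⟨s', x'⟩ hp
      have e : hybridMatrix I J w (fun a => s (Finset.equivFin _ a))
          (fun a => x (Finset.equivFin _ a)) = hybridMatrix I J w
          (fun a => s' (Finset.equivFin _ a)) (fun a => x' (Finset.equivFin _ a)) :=
        congrArg Subtype.val hp
      refine Prod.ext (funext fun i => ?_) (funext fun i => ?_)
      · obtain ⟨a, rfl⟩ := (Finset.equivFin _).surjective i
        have := congrFun (congrFun e (w a)) (J a)
        rw [hybridMatrix_unit, hybridMatrix_unit] at this
        exact Units.ext this
      · obtain ⟨a, rfl⟩ := (Finset.equivFin _).surjective i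
        have := congrFun (congrFun e (w a.1.1)) a.1.2
        rwa [hybridMatrix_free, hybridMatrix_free] at this
    · rintro ⟨X, hX⟩
      obtain ⟨⟨h1, h2⟩, h3, h4, h5⟩ := (mem_hybrid_iff X).1 hX
      choose s hs using h4
      refine ⟨(fun i => s ((Finset.equivFin _).symm i).1, fun i =>
        X (w ((Finset.equivFin _).symm i).1.1) ((Finset.equivFin _).symm i).1.2),
        Subtype.ext (Eq.symm (eq_hybridMatrix
          (s := fun a => s ((Finset.equivFin _).symm (Finset.equivFin _ a)).1)
          (x := fun p => X (w ((Finset.equivFin _).symm (Finset.equivFin _ p)).1.1)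
            ((Finset.equivFin _).symm (Finset.equivFin _ p)).1.2)
          h2 (fun a => ?_) (fun p => ?_) (fun a l e1 e2 e3 => ?_)))⟩
      · simp only [Equiv.symm_apply_apply]
        exact (hs a).symm
      · simp only [Equiv.symm_apply_apply]
      -- A position of none of the three nonzero kinds is left of `I (w a)`, right of `J a`, or in a
      -- column `J b` cleared by an inversion. In each case the entry is forced to vanish.
      · rcases lt_or_gt_of_ne e1 with e1 | e1
        · exact h1 a l e1
        rcases lt_or_gt_of_ne e2 with e2 | e2
        · simp only [freePositions, Finset.mem_filter, Finset.mem_univ, true_and] at e3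
          push Not at e3
          obtain ⟨b, hb, hw, rfl⟩ := e3 e1 e2
          exact h5 a b hb hw
        · exact h3 a l e2
  exact NatIso.isIso_of_isIso_app _

end Coordinates

end GaussDecomposition

open CategoryTheory GaussDecomposition in
theorem mainTheorem2 {k : Type*} [Field k] {d n : ℕ} (I J : Fin d ↪o Fin n)
    (hIJ : ∀ a, I a ≤ J a) (w : Equiv.Perm (Fin d)) :
    (∃ φ : (hybrid k I J w).toFunctor ≅ (stratum k I J w).toFunctor,
      φ.hom ≫ (stratum k I J w).ι ≫ (richardson k I J).ι =
        Subfunctor.homOfLe (hybrid_le_fullRank k I J w) ≫ rowSpan k d n) ∧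
    (∀ A : CommAlgCat k, Nontrivial A →
      (((stratum k I J w).obj A).Nonempty ↔ ∀ a, I (w a) ≤ J a)) ∧
    ((∀ a, I (w a) ≤ J a) →
      ∃ α β : ℕ, α = (Finset.univ.filter fun a => I (w a) ≠ J a).card ∧
        (β : ℤ) = subsetLength J - subsetLength I - α - permLength w ∧
        Nonempty ((stratum k I J w).toFunctor ≅ gmAffine k α β)) := by
  refine ⟨⟨asIso (hybridToStratum k I J w), rfl⟩, fun A _ => ⟨?_, fun h => ?_⟩, fun h =>
    ⟨_, (freePositions I J w).card, rfl, card_freePositions h,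
      ⟨(asIso (gmAffineToHybrid h) ≪≫ asIso (hybridToStratum k I J w)).symm⟩⟩⟩
  · rintro ⟨W, hW⟩
    obtain ⟨X, hX, -⟩ := exists_hybrid_of_mem_stratum W hW
    exact le_of_mem_hybrid hX
  -- Non-emptiness over every algebra is witnessed by setting all unit coordinates to `1` and all
  -- free ones to `0`.
  · exact ⟨_, rowPoint_mem_stratum (hybridMatrix_mem h A (fun _ => 1) (fun _ => 0))
      (hybrid_le_fullRank k I J w A (hybridMatrix_mem h A _ _))⟩
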